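/- Let $k$ be a perfect field of characteristic $p>0$. For a field extension $K/k$ with perfect closure $K^{\mathrm{perf}}$, let $\mathcal D_\infty(K/k)$ be the category of triples $(V,W,\psi)$, where $V$ is a finite dimensional $K$-vector space, $W$ is a finite dimensional $k$-vector space and $\psi\colon K^{\mathrm{perf}}\otimes_K V\to K^{\mathrm{perf}}\otimes_k W$ is a $K^{\mathrm{perf}}$-linear isomorphism; a morphism is a pair consisting of a $K$-linear and a $k$-linear map compatible with the isomorphisms $\psi$. Let $\pi^{\mathrm L}(K/k)$ be the Tannakian group scheme over $k$ of $\mathcal D_\infty(K/k)$, i.e. the group scheme $\underline{\mathrm{Aut}}^{\otimes}(\omega)$ of tensor automorphisms of the fibre functor $\omega\colon (V,W,\psi)\mapsto W$. For an extension $L/K$, the pullback functor $(V,W,\psi)\mapsto (L\otimes_K V,W,L^{\mathrm{perf}}\otimes_{K^{\mathrm{perf}}}\psi)$ induces a homomorphism $\pi^{\mathrm L}(L/k)\to\pi^{\mathrm L}(K/k)$; for $L/K$ purely inseparable, $\pi^{\mathrm L}(L/k)$ is regarded through it as a subgroup of $\pi^{\mathrm L}(K/k)$. Let $K/k$ be a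 field extension such that $K$ is not perfect. Then: 1. There is a closed subgroup $H$ of $\pi^{\mathrm L}(K/k)$ which is not of the form $\pi^{\mathrm L}(L/k)$ for any purely inseparable extension $L/K$. 2. If $L/K$ is a nontrivial purely inseparable extension, then the quotient $\pi^{\mathrm L}(K/k)/\pi^{\mathrm L}(L/k)$ is not finite over $k$: the fpqc quotient is not the spectrum of a finite $k$-algebra and, moreover, the $k$-algebra of functions on it (the functions on $\pi^{\mathrm L}(K/k)$ invariant under right translation by $\pi^{\mathrm L}(L/k)$) is infinite dimensional over $k$. 3. If $\lambda\in K$ is not a $p$-th power in $K$ and $L=K[X]/(X^p-\lambda)$, then the group $L^*/K^*$ is infinite and not finitely generated. -/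

import Mathlib

open CategoryTheory TensorProduct

universe u

noncomputable section

namespace LocalNori

/-! ## Base change of endomorphisms along a map of `k`-algebras -/

section BaseChange

variable {k : Type u} [CommRing k] {R S T : Type u} [CommRing R] [Algebra k R] [CommRing S]
  [Algebra k S] [CommRing T] [Algebra k T] (W : Type u) [AddCommGroup W] [Module k W]

/-- The map `R ⊗ W → S ⊗ W` induced by a `k`-algebra map `f : R → S`. -/
def extend (f : R →ₐ[k] S) : R ⊗[k] W →ₗ[k] S ⊗[k] W := f.toLinearMap.rTensor W

@[simp] lemma extend_tmul (f : R →ₐ[k] S) (r : R) (w : W) :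
    extend W f (r ⊗ₜ w) = f r ⊗ₜ w := rfl

lemma extend_smul (f : R →ₐ[k] S) (r : R) (x : R ⊗[k] W) :
    extend W f (r • x) = f r • extend W f x := by
  induction x with
  | zero => simp
  | tmul a w => simp [TensorProduct.smul_tmul']
  | add a b ha hb => simp [ha, hb]

variable {W}

/-- The `S`-linear endomorphism of `S ⊗ W` obtained from an `R`-linear endomorphism of `R ⊗ W`
by base change along `f`; it sends `1 ⊗ w` to the image of `e (1 ⊗ w)`. -/
def endMapFun (f : R →ₐ[k] S) (e : Module.End R (R ⊗[k] W)) : Module.End S (S ⊗[k] W) :=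
  LinearMap.liftBaseChange S
    (extend W f ∘ₗ (e.restrictScalars k) ∘ₗ (TensorProduct.mk k R W 1))

lemma endMapFun_one_tmul (f : R →ₐ[k] S) (e : Module.End R (R ⊗[k] W)) (w : W) :
    endMapFun f e (1 ⊗ₜ w) = extend W f (e (1 ⊗ₜ w)) := by
  simp [endMapFun]

lemma endMapFun_extend (f : R →ₐ[k] S) (e : Module.End R (R ⊗[k] W)) (x : R ⊗[k] W) :
    endMapFun f e (extend W f x) = extend W f (e x) := by
  induction x with
  | zero => simp
  | tmul r w =>
    have h1 : (r ⊗ₜ[k] w : R ⊗[k] W) = r • ((1 : R) ⊗ₜ[k] w) := by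
      simp [TensorProduct.smul_tmul']
    rw [h1, extend_smul, map_smul, map_smul, extend_smul]
    simp [endMapFun_one_tmul]
  | add a b ha hb => simp [ha, hb]

lemma end_ext {e e' : Module.End S (S ⊗[k] W)} (h : ∀ w : W, e (1 ⊗ₜ w) = e' (1 ⊗ₜ w)) :
    e = e' := by
  apply TensorProduct.AlgebraTensorModule.curry_injective
  ext w
  simpa using h w

/-- Base change of endomorphisms, as a monoid homomorphism. -/
def endMap (f : R →ₐ[k] S) : Module.End R (R ⊗[k] W) →* Module.End S (S ⊗[k] W) where
  toFun := endMapFun f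
  map_one' := end_ext fun w => by simp [endMapFun_one_tmul]
  map_mul' a b := end_ext fun w => by
    rw [endMapFun_one_tmul, Module.End.mul_apply, Module.End.mul_apply, endMapFun_one_tmul,
      endMapFun_extend]

lemma endMap_extend (f : R →ₐ[k] S) (e : Module.End R (R ⊗[k] W)) (x : R ⊗[k] W) :
    endMap f e (extend W f x) = extend W f (e x) := endMapFun_extend f e x

lemma endMap_one_tmul (f : R →ₐ[k] S) (e : Module.End R (R ⊗[k] W)) (w : W) :
    endMap f e (1 ⊗ₜ w) = extend W f (e (1 ⊗ₜ w)) := endMapFun_one_tmul f e w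

lemma extend_id (x : R ⊗[k] W) : extend W (AlgHom.id k R) x = x := by
  simp [extend]

lemma extend_comp (f : R →ₐ[k] S) (g : S →ₐ[k] T) (x : R ⊗[k] W) :
    extend W (g.comp f) x = extend W g (extend W f x) := by
  simp [extend, LinearMap.rTensor_comp]

lemma endMap_id (e : Module.End R (R ⊗[k] W)) : endMap (AlgHom.id k R) e = e :=
  end_ext fun w => by rw [endMap_one_tmul, extend_id]

lemma endMap_comp (f : R →ₐ[k] S) (g : S →ₐ[k] T) (e : Module.End R (R ⊗[k] W)) :
    endMap (g.comp f) e = endMap g (endMap f e) :=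
  end_ext fun w => by
    rw [endMap_one_tmul, endMap_one_tmul, endMap_one_tmul, extend_comp]

end BaseChange

/-! ## The category of triples -/

/-- A triple `(V, W, ψ)`: a finite dimensional `K`-vector space `V`, a finite dimensional
`k`-vector space `W` and an `Ω`-linear isomorphism `ψ : Ω ⊗_K V ≃ Ω ⊗_k W`.
For `Ω` a perfect closure of `K` these are the objects of the category `𝒟_∞(K/k)`. -/
structure Triple (k K Ω : Type u) [Field k] [Field K] [Field Ω] [Algebra k Ω] [Algebra K Ω] where
  V : Type u
  W : Type u
  [addCommGroupV : AddCommGroup V]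
  [moduleV : Module K V]
  [finiteV : Module.Finite K V]
  [addCommGroupW : AddCommGroup W]
  [moduleW : Module k W]
  [finiteW : Module.Finite k W]
  ψ : Ω ⊗[K] V ≃ₗ[Ω] Ω ⊗[k] W

namespace Triple

attribute [instance] addCommGroupV moduleV finiteV addCommGroupW moduleW finiteW

variable {k K Ω : Type u} [Field k] [Field K] [Field Ω] [Algebra k Ω] [Algebra K Ω]

/-- A morphism of triples: a `K`-linear map `a` and a `k`-linear map `b`
compatible with the isomorphisms `ψ`. -/
@[ext]
structure Hom (X Y : Triple k K Ω) where
  a : X.V →ₗ[K] Y.V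
  b : X.W →ₗ[k] Y.W
  comm : ∀ x : Ω ⊗[K] X.V, Y.ψ (a.baseChange Ω x) = b.baseChange Ω (X.ψ x)

instance : Category (Triple k K Ω) where
  Hom X Y := Hom X Y
  id X := ⟨LinearMap.id, LinearMap.id, fun x => by simp⟩
  comp f g := ⟨g.a ∘ₗ f.a, g.b ∘ₗ f.b, fun x => by
    simp [LinearMap.baseChange_comp, f.comm, g.comm]⟩

/-- The tensor product `(V ⊗_K V', W ⊗_k W', ψ ⊗ ψ')`. -/
abbrev tensor (X Y : Triple k K Ω) : Triple k K Ω where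
  V := X.V ⊗[K] Y.V
  W := X.W ⊗[k] Y.W
  ψ := AlgebraTensorModule.distribBaseChange K Ω X.V Y.V ≪≫ₗ
    TensorProduct.congr X.ψ Y.ψ ≪≫ₗ
    (AlgebraTensorModule.distribBaseChange k Ω X.W Y.W).symm

lemma tensor_ψ (X Y : Triple k K Ω) (v : X.V) (w : Y.V) :
    (X.tensor Y).ψ (1 ⊗ₜ (v ⊗ₜ w)) =
      (AlgebraTensorModule.distribBaseChange k Ω X.W Y.W).symm (X.ψ (1 ⊗ₜ v) ⊗ₜ Y.ψ (1 ⊗ₜ w)) := by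
  simp [AlgebraTensorModule.distribBaseChange_tmul]

variable (k K Ω) in
/-- The unit triple `(K, k, can)`. -/
abbrev unit : Triple k K Ω where
  V := K
  W := k
  ψ := AlgebraTensorModule.rid K Ω Ω ≪≫ₗ (AlgebraTensorModule.rid k Ω Ω).symm

end Triple

/-! ## The Tannakian group -/

section Tannaka

variable (k K Ω : Type u) [Field k] [Field K] [Field Ω] [Algebra k Ω] [Algebra K Ω]

/-- The group `Aut^⊗(ω_R)` of `R`-linear tensor automorphisms of the fibre functor
`ω_R : (V, W, ψ) ↦ R ⊗_k W`. -/
def tensorAut (R : Type u) [CommRing R] [Algebra k R] :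
    Subgroup (∀ X : Triple k K Ω, LinearMap.GeneralLinearGroup R (R ⊗[k] X.W)) where
  carrier := {g |
    (∀ (X Y : Triple k K Ω) (φ : X ⟶ Y) (x : R ⊗[k] X.W),
      (g Y).1 (φ.b.baseChange R x) = φ.b.baseChange R ((g X).1 x)) ∧
    (∀ (X Y : Triple k K Ω) (x : R ⊗[k] (X.W ⊗[k] Y.W)),
      AlgebraTensorModule.distribBaseChange k R X.W Y.W ((g (X.tensor Y)).1 x) =
        TensorProduct.map (g X).1 (g Y).1
          (AlgebraTensorModule.distribBaseChange k R X.W Y.W x)) ∧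
    g (Triple.unit k K Ω) = 1}
  one_mem' := by
    refine ⟨fun X Y φ x => by simp, fun X Y x => ?_, rfl⟩
    change _ = TensorProduct.map LinearMap.id LinearMap.id _
    rw [TensorProduct.map_id]
    rfl
  mul_mem' := by
    rintro g h ⟨g1, g2, g3⟩ ⟨h1, h2, h3⟩
    refine ⟨fun X Y φ x => ?_, fun X Y x => ?_, by simp [g3, h3]⟩
    · simp [h1, g1]
    · change AlgebraTensorModule.distribBaseChange k R X.W Y.W
        ((g (X.tensor Y)).1 ((h (X.tensor Y)).1 x)) =
        TensorProduct.map ((g X).1 ∘ₗ (h X).1) ((g Y).1 ∘ₗ (h Y).1) _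
      rw [g2, h2, TensorProduct.map_comp]
      rfl
  inv_mem' := by
    rintro g ⟨g1, g2, g3⟩
    have hr : ∀ (X : Triple k K Ω) x, (g X).1 ((g⁻¹ X).1 x) = x := fun X x => by
      change ((g X).1 * ((g X)⁻¹).1) x = x
      simp
    have hl : ∀ (X : Triple k K Ω) x, (g⁻¹ X).1 ((g X).1 x) = x := fun X x => by
      change (((g X)⁻¹).1 * (g X).1) x = x
      simp
    refine ⟨fun X Y φ x => ?_, fun X Y x => ?_, by simp [g3]⟩
    · rw [← hl Y (φ.b.baseChange R ((g⁻¹ X).1 x)), g1, hr]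
    · have key := g2 X Y ((g⁻¹ (X.tensor Y)).1 x)
      have hr' := hr (X.tensor Y) x
      rw [hr'] at key
      rw [key]
      generalize AlgebraTensorModule.distribBaseChange k R X.W Y.W
        ((g⁻¹ (X.tensor Y)).1 x) = z
      have : TensorProduct.map (g⁻¹ X).1 (g⁻¹ Y).1 ∘ₗ TensorProduct.map (g X).1 (g Y).1
          = LinearMap.id := by
        refine TensorProduct.ext' fun a b => ?_
        simp only [LinearMap.comp_apply, TensorProduct.map_tmul, hl, LinearMap.id_apply]
      exact (LinearMap.congr_fun this z).symm

variable {k} in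
lemma distrib_extend_symm {R S : Type u} [CommRing R] [Algebra k R] [CommRing S] [Algebra k S]
    (f : R →ₐ[k] S) (W W' : Type u) [AddCommGroup W] [Module k W] [AddCommGroup W'] [Module k W']
    (x : R ⊗[k] W) (y : R ⊗[k] W') :
    AlgebraTensorModule.distribBaseChange k S W W'
      (extend (W ⊗[k] W') f ((AlgebraTensorModule.distribBaseChange k R W W').symm (x ⊗ₜ y))) =
      extend W f x ⊗ₜ extend W' f y := by
  induction x with
  | zero => simp
  | add a b ha hb => simp only [TensorProduct.add_tmul, map_add, ha, hb]
  | tmul r w =>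
    induction y with
    | zero => simp
    | add a b ha hb => simp only [TensorProduct.tmul_add, map_add, ha, hb]
    | tmul r' w' =>
      have h1 : (AlgebraTensorModule.distribBaseChange k R W W').symm
          ((r ⊗ₜ[k] w) ⊗ₜ[R] (r' ⊗ₜ[k] w')) = (r * r') ⊗ₜ[k] (w ⊗ₜ[k] w') := by
        rw [LinearEquiv.symm_apply_eq, AlgebraTensorModule.distribBaseChange_tmul]
        rw [mul_comm, show (r' * r) ⊗ₜ[k] w = r' • (r ⊗ₜ[k] w) by
          simp [TensorProduct.smul_tmul'], TensorProduct.smul_tmul]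
        simp [TensorProduct.smul_tmul']
      rw [h1, extend_tmul, extend_tmul, extend_tmul,
        AlgebraTensorModule.distribBaseChange_tmul, map_mul, mul_comm,
        show (f r' * f r) ⊗ₜ[k] w = f r' • (f r ⊗ₜ[k] w) by
          simp [TensorProduct.smul_tmul'], TensorProduct.smul_tmul]
      simp [TensorProduct.smul_tmul']

variable {k} in
lemma distrib_extend {R S : Type u} [CommRing R] [Algebra k R] [CommRing S] [Algebra k S]
    (f : R →ₐ[k] S) (W W' : Type u) [AddCommGroup W] [Module k W] [AddCommGroup W'] [Module k W']
    (e : Module.End R (R ⊗[k] (W ⊗[k] W'))) (a : Module.End R (R ⊗[k] W))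
    (b : Module.End R (R ⊗[k] W'))
    (h : ∀ x, AlgebraTensorModule.distribBaseChange k R W W' (e x) =
      TensorProduct.map a b (AlgebraTensorModule.distribBaseChange k R W W' x))
    (x : S ⊗[k] (W ⊗[k] W')) :
    AlgebraTensorModule.distribBaseChange k S W W' (endMap f e x) =
      TensorProduct.map (endMap f a) (endMap f b)
        (AlgebraTensorModule.distribBaseChange k S W W' x) := by
  suffices H : (AlgebraTensorModule.distribBaseChange k S W W').toLinearMap ∘ₗ endMap f e =
      TensorProduct.map (endMap f a) (endMap f b) ∘ₗ
        (AlgebraTensorModule.distribBaseChange k S W W').toLinearMap from LinearMap.congr_fun H x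
  apply TensorProduct.AlgebraTensorModule.curry_injective
  ext w w'
  have h' : e (1 ⊗ₜ (w ⊗ₜ w')) = (AlgebraTensorModule.distribBaseChange k R W W').symm
      (a (1 ⊗ₜ w) ⊗ₜ b (1 ⊗ₜ w')) := by
    rw [LinearEquiv.eq_symm_apply, h, AlgebraTensorModule.distribBaseChange_tmul,
      TensorProduct.map_tmul]
  have h2 : AlgebraTensorModule.distribBaseChange k S W W' (endMap f e (1 ⊗ₜ (w ⊗ₜ w'))) =
      TensorProduct.map (endMap f a) (endMap f b)
        (AlgebraTensorModule.distribBaseChange k S W W' (1 ⊗ₜ (w ⊗ₜ w'))) := by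
    rw [endMap_one_tmul, h', distrib_extend_symm, AlgebraTensorModule.distribBaseChange_tmul,
      TensorProduct.map_tmul, endMap_one_tmul, endMap_one_tmul]
  exact h2

lemma baseChange_extend {R S : Type u} [CommRing R] [Algebra k R] [CommRing S] [Algebra k S]
    (f : R →ₐ[k] S) {W W' : Type u} [AddCommGroup W] [Module k W] [AddCommGroup W'] [Module k W']
    (b : W →ₗ[k] W') (x : R ⊗[k] W) :
    b.baseChange S (extend W f x) = extend W' f (b.baseChange R x) := by
  induction x with
  | zero => simp
  | add a b ha hb => simp only [map_add, ha, hb]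
  | tmul r w => simp

/-- The map `Aut^⊗(ω_R) → Aut^⊗(ω_S)` given by base change along `f : R → S`. -/
def tensorAutMap {R S : Type u} [CommRing R] [Algebra k R] [CommRing S] [Algebra k S]
    (f : R →ₐ[k] S) : tensorAut k K Ω R →* tensorAut k K Ω S where
  toFun g := ⟨fun X => Units.map (endMap f) (g.1 X), by
    obtain ⟨g, g1, g2, g3⟩ := g
    refine ⟨fun X Y φ x => ?_, fun X Y x => ?_, ?_⟩
    · suffices H : endMap f (g Y).1 ∘ₗ φ.b.baseChange S = φ.b.baseChange S ∘ₗ endMap f (g X).1 from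
        LinearMap.congr_fun H x
      apply TensorProduct.AlgebraTensorModule.curry_injective
      ext w
      have : endMap f (g Y).1 (φ.b.baseChange S (1 ⊗ₜ w)) =
          φ.b.baseChange S (endMap f (g X).1 (1 ⊗ₜ w)) := by
        rw [endMap_one_tmul, baseChange_extend, ← g1]
        simp [endMap_one_tmul]
      exact this
    · exact distrib_extend f X.W Y.W _ _ _ (g2 X Y) x
    · simp only [g3]
      exact map_one _⟩
  map_one' := by
    ext1; funext X; exact map_one _
  map_mul' g h := by
    ext1; funext X; exact map_mul _ _ _

/-- The Tannakian group scheme of the category of triples with respect to the fibre functor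
`(V, W, ψ) ↦ W`, as a functor of points on commutative `k`-algebras. -/
def tannakaGroup : CommAlgCat.{u} k ⥤ GrpCat.{u + 1} where
  obj R := GrpCat.of (tensorAut k K Ω R)
  map f := GrpCat.ofHom (tensorAutMap k K Ω f.hom)
  map_id R := by
    refine GrpCat.hom_ext (MonoidHom.ext fun g => Subtype.ext (funext fun X => ?_))
    exact Units.ext (endMap_id _)
  map_comp f g := by
    refine GrpCat.hom_ext (MonoidHom.ext fun x => Subtype.ext (funext fun X => ?_))
    exact Units.ext (endMap_comp _ _ _)

end Tannaka

/-! ## Functoriality in the field -/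

section Pullback

variable {k K Ω : Type u} [Field k] [Field K] [Field Ω] [Algebra k Ω] [Algebra K Ω]
  (L Ω' : Type u) [Field L] [Field Ω'] [Algebra k Ω'] [Algebra L Ω'] [Algebra K L]
  [Algebra K Ω'] [IsScalarTower K L Ω'] [Algebra Ω Ω'] [IsScalarTower K Ω Ω']
  [IsScalarTower k Ω Ω']

namespace Triple

/-- The pullback functor `(V, W, ψ) ↦ (L ⊗_K V, W, Ω' ⊗_Ω ψ)` on objects, with the canonical
identifications `Ω' ⊗_L (L ⊗_K V) ≃ Ω' ⊗_K V ≃ Ω' ⊗_Ω (Ω ⊗_K V)` and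
`Ω' ⊗_Ω (Ω ⊗_k W) ≃ Ω' ⊗_k W`. -/
abbrev pullback (X : Triple k K Ω) : Triple k L Ω' where
  V := L ⊗[K] X.V
  W := X.W
  ψ := AlgebraTensorModule.cancelBaseChange K L Ω' Ω' X.V ≪≫ₗ
    (AlgebraTensorModule.cancelBaseChange K Ω Ω' Ω' X.V).symm ≪≫ₗ
    X.ψ.baseChange Ω Ω' _ _ ≪≫ₗ
    AlgebraTensorModule.cancelBaseChange k Ω Ω' Ω' X.W

lemma pullback_ψ (X : Triple k K Ω) (v : X.V) :
    (X.pullback L Ω').ψ (1 ⊗ₜ (1 ⊗ₜ v)) =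
      extend X.W (IsScalarTower.toAlgHom k Ω Ω') (X.ψ (1 ⊗ₜ v)) := by
  have h : ∀ y : Ω ⊗[k] X.W, AlgebraTensorModule.cancelBaseChange k Ω Ω' Ω' X.W (1 ⊗ₜ y) =
      extend X.W (IsScalarTower.toAlgHom k Ω Ω') y := fun y => by
    induction y with
    | zero => simp
    | add a b ha hb => simp only [TensorProduct.tmul_add, map_add, ha, hb]
    | tmul r w => simp [Algebra.smul_def]
  rw [← h]
  simp

/-- Two linear maps out of `Ω' ⊗_L (L ⊗_K V)` that agree on the elements `1 ⊗ 1 ⊗ v` agree. -/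
lemma pullback_ext {V M : Type u} [AddCommGroup V] [Module K V] [AddCommGroup M] [Module Ω' M]
    (f g : Ω' ⊗[L] (L ⊗[K] V) →ₗ[Ω'] M)
    (h : ∀ v : V, f (1 ⊗ₜ (1 ⊗ₜ v)) = g (1 ⊗ₜ (1 ⊗ₜ v))) (x : Ω' ⊗[L] (L ⊗[K] V)) :
    f x = g x := by
  induction x with
  | zero => simp
  | add a b ha hb => simp only [map_add, ha, hb]
  | tmul r y =>
    induction y with
    | zero => simp
    | add a b ha hb => simp only [TensorProduct.tmul_add, map_add, ha, hb]
    | tmul l v =>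
      have e : r ⊗ₜ[L] (l ⊗ₜ[K] v) = (r * algebraMap L Ω' l) • ((1 : Ω') ⊗ₜ[L] ((1 : L) ⊗ₜ[K] v)) := by
        rw [TensorProduct.smul_tmul', smul_eq_mul, mul_one,
          show r * algebraMap L Ω' l = l • r by rw [Algebra.smul_def, mul_comm],
          TensorProduct.smul_tmul, TensorProduct.smul_tmul', smul_eq_mul, mul_one]
      rw [e, map_smul, map_smul, h]

/-- The pullback functor on morphisms. -/
def pullbackHom {X Y : Triple k K Ω} (φ : X ⟶ Y) : X.pullback L Ω' ⟶ Y.pullback L Ω' where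
  a := φ.a.baseChange L
  b := φ.b
  comm := pullback_ext L Ω'
    ((Y.pullback L Ω').ψ.toLinearMap ∘ₗ (φ.a.baseChange L).baseChange Ω')
    (φ.b.baseChange Ω' ∘ₗ (X.pullback L Ω').ψ.toLinearMap) fun v => by
      have h1 := pullback_ψ L Ω' Y (φ.a v)
      have h2 := pullback_ψ L Ω' X v
      have h3 := φ.comm (1 ⊗ₜ v)
      rw [LinearMap.baseChange_tmul] at h3
      rw [LinearMap.comp_apply, LinearMap.comp_apply, LinearMap.baseChange_tmul,
        LinearMap.baseChange_tmul, LinearEquiv.coe_coe, LinearEquiv.coe_coe]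
      erw [h1, h2]
      rw [h3, baseChange_extend]

/-- The pullback functor is compatible with tensor products. -/
def pullbackTensor (X Y : Triple k K Ω) :
    (X.tensor Y).pullback L Ω' ⟶ (X.pullback L Ω').tensor (Y.pullback L Ω') where
  a := (AlgebraTensorModule.distribBaseChange K L X.V Y.V).toLinearMap
  b := LinearMap.id
  comm := pullback_ext L Ω'
    (((X.pullback L Ω').tensor (Y.pullback L Ω')).ψ.toLinearMap ∘ₗ
      (AlgebraTensorModule.distribBaseChange K L X.V Y.V).toLinearMap.baseChange Ω')
    (LinearMap.id.baseChange Ω' ∘ₗ ((X.tensor Y).pullback L Ω').ψ.toLinearMap) fun v => by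
      rw [LinearMap.comp_apply, LinearMap.comp_apply, LinearMap.baseChange_tmul,
        LinearEquiv.coe_coe, LinearEquiv.coe_coe, LinearEquiv.coe_coe, LinearMap.baseChange_id,
        LinearMap.id_apply, pullback_ψ]
      induction v with
      | zero => simp only [TensorProduct.tmul_zero, map_zero]
      | add a b ha hb => simp only [TensorProduct.tmul_add, map_add, ha, hb]
      | tmul v w =>
        rw [tensor_ψ, AlgebraTensorModule.distribBaseChange_tmul]
        erw [tensor_ψ, pullback_ψ, pullback_ψ]
        rw [LinearEquiv.symm_apply_eq, distrib_extend_symm]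

/-- The pullback functor is compatible with unit objects. -/
def pullbackUnit : (unit k K Ω).pullback L Ω' ⟶ unit k L Ω' where
  a := (AlgebraTensorModule.rid K L L).toLinearMap
  b := LinearMap.id
  comm := pullback_ext L Ω'
    ((unit k L Ω').ψ.toLinearMap ∘ₗ (AlgebraTensorModule.rid K L L).toLinearMap.baseChange Ω')
    (LinearMap.id.baseChange Ω' ∘ₗ ((unit k K Ω).pullback L Ω').ψ.toLinearMap) fun v => by
      rw [LinearMap.comp_apply, LinearMap.comp_apply, LinearMap.baseChange_tmul,
        LinearEquiv.coe_coe, LinearEquiv.coe_coe, LinearEquiv.coe_coe, LinearMap.baseChange_id,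
        LinearMap.id_apply, pullback_ψ]
      simp [Algebra.smul_def, ← IsScalarTower.algebraMap_apply]

end Triple

/-- The homomorphism of Tannakian groups induced by the pullback functor. -/
def tannakaMap : tannakaGroup k L Ω' ⟶ tannakaGroup k K Ω where
  app R := GrpCat.ofHom
    { toFun g := ⟨fun X => g.1 (X.pullback L Ω'), by
        obtain ⟨g, g1, g2, g3⟩ := g
        refine ⟨fun X Y φ x => g1 _ _ (Triple.pullbackHom L Ω' φ) x, fun X Y x => ?_, ?_⟩
        · have h := g1 _ _ (Triple.pullbackTensor L Ω' X Y) x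
          have h2 := g2 (X.pullback L Ω') (Y.pullback L Ω') x
          simp only [Triple.pullbackTensor, LinearMap.baseChange_id, LinearMap.id_apply] at h
          rw [← h2]
          exact congrArg _ h.symm
        · refine Units.ext (LinearMap.ext fun x => ?_)
          have h := g1 _ _ (Triple.pullbackUnit (k := k) (K := K) (Ω := Ω) L Ω') x
          simp only [Triple.pullbackUnit, LinearMap.baseChange_id, LinearMap.id_apply, g3] at h
          exact h.symm⟩
      map_one' := rfl
      map_mul' _ _ := rfl }
  naturality _ _ _ := rfl

end Pullback

/-! ## The local Nori fundamental group -/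

section Perf

variable (p : ℕ) [Fact p.Prime]

/-- The perfect closure of `K` as an algebra over every subfield of `K`. -/
instance perfectClosureAlgebra (A K : Type u) [Field A] [Field K] [CharP K p] [Algebra A K] :
    Algebra A (PerfectClosure K p) :=
  ((PerfectClosure.of K p).comp (algebraMap A K)).toAlgebra

lemma perfectClosure_algebraMap (A K : Type u) [Field A] [Field K] [CharP K p] [Algebra A K]
    (a : A) : algebraMap A (PerfectClosure K p) a = PerfectClosure.of K p (algebraMap A K a) :=
  rfl

variable (k K L : Type u) [Field k] [Field K] [CharP K p] [Field L] [CharP L p]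
  [Algebra k K] [Algebra k L] [Algebra K L] [IsScalarTower k K L]

/-- The map `K^perf → L^perf` extending `K → L`. -/
def perfectClosureMap : PerfectClosure K p →+* PerfectClosure L p :=
  PerfectClosure.lift K p (PerfectClosure L p) ((PerfectClosure.of L p).comp (algebraMap K L))

lemma perfectClosureMap_of (x : K) :
    perfectClosureMap p K L (PerfectClosure.of K p x) =
      PerfectClosure.of L p (algebraMap K L x) :=
  RingHom.congr_fun ((PerfectClosure.lift K p (PerfectClosure L p)).symm_apply_apply
    ((PerfectClosure.of L p).comp (algebraMap K L))) x

/-- The local Nori fundamental group `π^L(K/k)`: the Tannakian group scheme of the category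
`𝒟_∞(K/k)` of triples `(V, W, ψ : K^perf ⊗_K V ≃ K^perf ⊗_k W)`, as a functor of points. -/
def localNoriGroup : CommAlgCat.{u} k ⥤ GrpCat.{u + 1} :=
  tannakaGroup k K (PerfectClosure K p)

/-- The homomorphism `π^L(L/k) → π^L(K/k)` induced by a field extension `L/K` over `k`. -/
def localNoriGroupMap : localNoriGroup p k L ⟶ localNoriGroup p k K :=
  letI : Algebra (PerfectClosure K p) (PerfectClosure L p) := (perfectClosureMap p K L).toAlgebra
  haveI : IsScalarTower K L (PerfectClosure L p) := IsScalarTower.of_algebraMap_eq fun _ => rfl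
  haveI : IsScalarTower K (PerfectClosure K p) (PerfectClosure L p) :=
    IsScalarTower.of_algebraMap_eq fun x => (perfectClosureMap_of p K L x).symm
  haveI : IsScalarTower k (PerfectClosure K p) (PerfectClosure L p) :=
    IsScalarTower.of_algebraMap_eq fun x => by
      rw [perfectClosure_algebraMap, IsScalarTower.algebraMap_apply k K L]
      exact (perfectClosureMap_of p K L _).symm
  tannakaMap L (PerfectClosure L p)

end Perf

/-! ## Subgroups and quotients of group functors -/

section GroupFunctor

variable {k : Type u} [Field k]

/-- A closed subgroup functor of a group functor `G` on commutative `k`-algebras: for every point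
`g ∈ G(R)` the condition that `g` lies in the subgroup is represented by a closed subscheme
`Spec (R/I)` of `Spec R`. For an affine group scheme these are its closed subgroup schemes. -/
structure ClosedSubgroup (G : CommAlgCat.{u} k ⥤ GrpCat.{u + 1}) where
  carrier : ∀ R : CommAlgCat.{u} k, Subgroup (G.obj R)
  map_mem : ∀ {R S : CommAlgCat.{u} k} (f : R ⟶ S) (g : G.obj R),
    g ∈ carrier R → G.map f g ∈ carrier S
  closed : ∀ (R : CommAlgCat.{u} k) (g : G.obj R), ∃ I : Ideal R,
    ∀ (S : CommAlgCat.{u} k) (f : R ⟶ S), G.map f g ∈ carrier S ↔ ∀ a ∈ I, f.hom a = 0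

/-- The image of a homomorphism of group functors, a family of subgroups of the target. -/
def imageSubgroup {G' G : CommAlgCat.{u} k ⥤ GrpCat.{u + 1}} (φ : G' ⟶ G)
    (R : CommAlgCat.{u} k) : Subgroup (G.obj R) := (φ.app R).hom.range

/-- The `k`-algebra of global functions on the quotient `G/H`: natural transformations
from `G` to the affine line that are invariant under right translation by `H`. -/
def quotientFunctions (G : CommAlgCat.{u} k ⥤ GrpCat.{u + 1})
    (H : ∀ R : CommAlgCat.{u} k, Subgroup (G.obj R)) :
    Subalgebra k (∀ R : CommAlgCat.{u} k, G.obj R → R) where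
  carrier := {F |
    (∀ (R S : CommAlgCat.{u} k) (f : R ⟶ S) (g : G.obj R), F S (G.map f g) = f.hom (F R g)) ∧
    ∀ (R : CommAlgCat.{u} k) (g h : G.obj R), h ∈ H R → F R (g * h) = F R g}
  mul_mem' := by
    rintro a b ⟨ha, ha'⟩ ⟨hb, hb'⟩
    exact ⟨fun R S f g => by simp [ha, hb], fun R g h hh => by simp [ha' R g h hh, hb' R g h hh]⟩
  add_mem' := by
    rintro a b ⟨ha, ha'⟩ ⟨hb, hb'⟩
    exact ⟨fun R S f g => by simp [ha, hb], fun R g h hh => by simp [ha' R g h hh, hb' R g h hh]⟩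
  algebraMap_mem' c := ⟨fun R S f g => by simp [Pi.algebraMap_apply], fun R g h hh => rfl⟩

/-- `q : G → Spec B` exhibits the affine `k`-scheme `Spec B` as the quotient `G/H` in the sense of
fpqc sheaves: the fibres of `q` are the cosets `gH`, and every point of `Spec B` lifts to `G`
after a faithfully flat extension. -/
structure IsQuotientMap (G : CommAlgCat.{u} k ⥤ GrpCat.{u + 1})
    (H : ∀ R : CommAlgCat.{u} k, Subgroup (G.obj R)) (B : CommAlgCat.{u} k)
    (q : ∀ R : CommAlgCat.{u} k, G.obj R → (B ⟶ R)) : Prop where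
  natural : ∀ (R S : CommAlgCat.{u} k) (f : R ⟶ S) (g : G.obj R), q S (G.map f g) = q R g ≫ f
  eq_iff : ∀ (R : CommAlgCat.{u} k) (g g' : G.obj R), q R g = q R g' ↔ g⁻¹ * g' ∈ H R
  locally_surjective : ∀ (R : CommAlgCat.{u} k) (x : B ⟶ R),
    ∃ (S : CommAlgCat.{u} k) (f : R ⟶ S), f.hom.toRingHom.FaithfullyFlat ∧
      ∃ g : G.obj S, q S g = x ≫ f

/-- The quotient `G/H` is a finite `k`-scheme, that is, the spectrum of a finite `k`-algebra. -/
def QuotientIsFinite (G : CommAlgCat.{u} k ⥤ GrpCat.{u + 1})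
    (H : ∀ R : CommAlgCat.{u} k, Subgroup (G.obj R)) : Prop :=
  ∃ (B : CommAlgCat.{u} k) (q : ∀ R : CommAlgCat.{u} k, G.obj R → (B ⟶ R)),
    Module.Finite k B ∧ IsQuotientMap G H B q

end GroupFunctor

/-- The quotient `L^* / K^*` of unit groups. -/
abbrev unitsQuotient (K L : Type u) [CommRing K] [CommRing L] [Algebra K L] : Type u :=
  Lˣ ⧸ (Units.map (algebraMap K L).toMonoidHom).range

end LocalNori

end

/-!
A unit `u` of `K^perf` defines the rank one triple `(K, k, u)`, hence a character `χ_u` of `π(K/k)`.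
It is trivial exactly when `u ∈ K`, and its restriction to `π(L/k)` is `χ_u` again, so that
restriction is trivial exactly when `u ∈ L`. The characters `χ_u` with `u ∈ L^*` are thus functions
on `π(K/k) / π(L/k)`, parametrised by `L^* / K^*`. Distinct characters are linearly independent and
`L^* / K^*` is infinite as soon as `L ≠ K`, so these functions form an infinite dimensional space.
On the other hand, if `u ∈ K^perf` is not in `K` and has degree `n` over `K`, then `u ^ n ∈ K`, so
`χ_u` takes values in `μ_n`, and it is a quotient map onto `μ_n`. The functions on the quotient by
the kernel of `χ_u` are therefore finite dimensional. If the kernel were `π(L/k)`, then `u ∈ L` and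
these functions would be infinite dimensional.

The group `L^* / K^*` is infinite because the elements `1 + a α` with `a ∈ K` have distinct classes
when `α ∈ L` is not in `K`; being torsion, it is then not finitely generated.
-/

noncomputable section

namespace LocalNori

section FaithfullyFlat

open CommAlgCat

variable {k : Type u} [Field k] {B R S : CommAlgCat.{u} k}

lemma exists_pushout_injective_of_faithfullyFlat (x : B ⟶ R) (f : B ⟶ S)
    (hf : f.hom.toRingHom.FaithfullyFlat) :
    ∃ (P : CommAlgCat.{u} k) (i : R ⟶ P) (j : S ⟶ P),
      x ≫ i = f ≫ j ∧ Function.Injective i.hom := by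
  let : Algebra B R := x.hom.toRingHom.toAlgebra
  let : Algebra B S := f.hom.toRingHom.toAlgebra
  have : IsScalarTower k B R := IsScalarTower.of_algebraMap_eq fun a => (x.hom.commutes a).symm
  have : IsScalarTower k B S := IsScalarTower.of_algebraMap_eq fun a => (f.hom.commutes a).symm
  have : Module.FaithfullyFlat B S := hf
  refine ⟨of k (R ⊗[B] S), ofHom Algebra.TensorProduct.includeLeft,
    ofHom (Algebra.TensorProduct.includeRight.restrictScalars k), ?_,
    FaithfulSMul.algebraMap_injective R (R ⊗[B] S)⟩
  ext b
  exact Algebra.TensorProduct.tmul_one_eq_one_tmul b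

lemma exists_kernelPair_descent_of_faithfullyFlat (f : B ⟶ S)
    (hf : f.hom.toRingHom.FaithfullyFlat) :
    ∃ (P : CommAlgCat.{u} k) (i j : S ⟶ P),
      f ≫ i = f ≫ j ∧ ∀ s, i.hom s = j.hom s → s ∈ Set.range f.hom := by
  let : Algebra B S := f.hom.toRingHom.toAlgebra
  have : IsScalarTower k B S := IsScalarTower.of_algebraMap_eq fun a => (f.hom.commutes a).symm
  have : Module.FaithfullyFlat B S := hf
  refine ⟨of k (S ⊗[B] S), ofHom Algebra.TensorProduct.includeLeft,
    ofHom (Algebra.TensorProduct.includeRight.restrictScalars k), ?_,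
    fun s hs => (Algebra.IsEffective.of_faithfullyFlat B S s).1 (sub_eq_zero.2 hs)⟩
  ext b
  exact Algebra.TensorProduct.tmul_one_eq_one_tmul b

end FaithfullyFlat

section Quotient

variable {k : Type u} [Field k] {G : CommAlgCat.{u} k ⥤ GrpCat.{u + 1}}
  {H : ∀ R : CommAlgCat.{u} k, Subgroup (G.obj R)}

lemma quotientFunctions_map_eq_of_inv_mul_mem (F : quotientFunctions G H)
    {R S P : CommAlgCat.{u} k} {g : G.obj R} {h : G.obj S} {i : R ⟶ P} {j : S ⟶ P}
    (hgh : (G.map i g)⁻¹ * G.map j h ∈ H P) : i.hom (F.1 R g) = j.hom (F.1 S h) := by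
  rw [← F.2.1, ← F.2.1, ← F.2.2 P (G.map i g) _ hgh, mul_inv_cancel_left]

/-- A function on `G/H` is determined by its value at a faithfully flat lift of the generic point
of `Spec B`, and that value descends to `B`. -/
theorem finite_quotientFunctions_of_generic_lift {B S : CommAlgCat.{u} k} [Module.Finite k B]
    {q : ∀ R : CommAlgCat.{u} k, G.obj R → (B ⟶ R)}
    (natural : ∀ (R S : CommAlgCat.{u} k) (f : R ⟶ S) (g : G.obj R),
      q S (G.map f g) = q R g ≫ f)
    (fibre : ∀ (R : CommAlgCat.{u} k) (g g' : G.obj R), q R g = q R g' → g⁻¹ * g' ∈ H R)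
    (g : G.obj S) (flat : (q S g).hom.toRingHom.FaithfullyFlat) :
    Module.Finite k (quotientFunctions G H) := by
  have map_eq (F : quotientFunctions G H) {R P : CommAlgCat.{u} k} (x : G.obj R) (i : R ⟶ P)
      (j : S ⟶ P) (hij : q R x ≫ i = q S g ≫ j) : i.hom (F.1 R x) = j.hom (F.1 S g) :=
    quotientFunctions_map_eq_of_inv_mul_mem F
      (fibre _ _ _ ((natural _ _ i x).trans (hij.trans (natural _ _ j g).symm)))
  let evalGeneric : quotientFunctions G H →ₗ[k] S :=
    { toFun F := F.1 S g
      map_add' _ _ := rfl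
      map_smul' _ _ := rfl }
  have descends : LinearMap.range evalGeneric ≤ LinearMap.range (q S g).hom.toLinearMap := by
    rintro _ ⟨F, rfl⟩
    obtain ⟨P, i, j, hij, mem_range⟩ := exists_kernelPair_descent_of_faithfullyFlat (q S g) flat
    exact mem_range _ (map_eq F g i j hij)
  have injective : Function.Injective evalGeneric := by
    refine (injective_iff_map_eq_zero evalGeneric).2 fun F hF => ?_
    ext R x
    obtain ⟨P, i, j, hij, hi⟩ := exists_pushout_injective_of_faithfullyFlat (q R x) (q S g) flat
    refine hi ((map_eq F x i j hij).trans ?_)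
    rw [show F.1 S g = 0 from hF, map_zero]
    exact (map_zero _).symm
  have : Module.Finite k (LinearMap.range evalGeneric) :=
    Module.Finite.of_injective _ (Submodule.inclusion_injective descends)
  exact Module.Finite.of_injective evalGeneric.rangeRestrict
    ((LinearMap.injective_rangeRestrict_iff _).2 injective)

theorem QuotientIsFinite.finite_quotientFunctions (h : QuotientIsFinite G H) :
    Module.Finite k (quotientFunctions G H) := by
  obtain ⟨B, q, _, hq⟩ := h
  obtain ⟨S, f, flat, g, hg⟩ := hq.locally_surjective B (𝟙 B)
  rw [Category.id_comp] at hg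
  subst hg
  exact finite_quotientFunctions_of_generic_lift hq.natural
    (fun R g g' => (hq.eq_iff R g g').1) g flat

end Quotient

lemma linearIndependent_of_joint_eigenvectors {k E ι κ : Type*} [Field k] [AddCommGroup E]
    [Module k E] (T : κ → Module.End k E) {v : ι → E} {μ : ι → κ → k}
    (hT : ∀ i j, T j (v i) = μ i j • v i) (hv : ∀ i, v i ≠ 0) (hμ : Function.Injective μ) :
    LinearIndependent k v := by
  classical
  rw [linearIndependent_iff']
  intro s
  induction s using Finset.induction_on with
  | empty => simp
  | insert a s ha ih =>
    intro c hc
    rw [Finset.sum_insert ha] at hc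
    have vanish (j : κ) : ∑ i ∈ s, (c i * (μ i j - μ a j)) • v i = 0 := by
      have h := congrArg (T j - algebraMap k (Module.End k E) (μ a j)) hc
      simpa [hT, Finset.smul_sum, sub_smul, mul_sub, mul_smul, smul_comm (μ a j)] using h
    have hs : ∀ i ∈ s, c i = 0 := fun i hi => by
      by_contra hci
      have same_eigenvalues : i = a := hμ <| funext fun j =>
        sub_eq_zero.1 ((mul_eq_zero.1 (ih _ (vanish j) i hi)).resolve_left hci)
      exact ha (same_eigenvalues ▸ hi)
    rw [Finset.sum_eq_zero fun i hi => by rw [hs i hi, zero_smul], add_zero] at hc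
    exact Finset.forall_mem_insert .. |>.2 ⟨(smul_eq_zero.1 hc).resolve_right (hv a), hs⟩

section Characters

variable {k : Type u} [Field k] (G : CommAlgCat.{u} k ⥤ GrpCat.{u + 1})

/-- The group of characters `G → 𝔾ₘ` of a group functor, as a subgroup of the families of
homomorphisms `G(R) → Rˣ`. -/
def characters : Subgroup (∀ R : CommAlgCat.{u} k, G.obj R →* (R : Type u)ˣ) where
  carrier := {χ | ∀ (R S : CommAlgCat.{u} k) (f : R ⟶ S) (g : G.obj R),
    χ S (G.map f g) = Units.map f.hom (χ R g)}
  one_mem' _ _ _ _ := (map_one _).symm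
  mul_mem' hχ hχ' R S f g :=
    (congrArg₂ (· * ·) (hχ R S f g) (hχ' R S f g)).trans (map_mul _ _ _).symm
  inv_mem' hχ R S f g := (congrArg (·⁻¹) (hχ R S f g)).trans (map_inv _ _).symm

variable {G}

/-- A character viewed as a function `G → 𝔸¹`. -/
def characterFunction (χ : characters G) (R : CommAlgCat.{u} k) (g : G.obj R) : R := χ.1 R g

lemma characterFunction_map (χ : characters G) {R S : CommAlgCat.{u} k} (f : R ⟶ S)
    (g : G.obj R) : characterFunction χ S (G.map f g) = f.hom (characterFunction χ R g) :=
  congrArg Units.val (χ.2 R S f g)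

lemma characterFunction_mul (χ : characters G) (R : CommAlgCat.{u} k) (g h : G.obj R) :
    characterFunction χ R (g * h) = characterFunction χ R g * characterFunction χ R h :=
  congrArg Units.val (map_mul (χ.1 R) g h)

lemma characterFunction_one (χ : characters G) (R : CommAlgCat.{u} k) :
    characterFunction χ R 1 = 1 :=
  congrArg Units.val (map_one (χ.1 R))

lemma characterFunction_injective : Function.Injective (characterFunction (G := G)) :=
  fun _ _ h => Subtype.ext <| funext fun R => MonoidHom.ext fun g =>
    Units.ext (congrFun (congrFun h R) g)

/-- The operator `F ↦ (g ↦ (id ⊗ l) (F (g h)))` on functions on `G`, for a point `h` of `G` with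
values in `S` and a linear form `l` on `S`; the product `g h` is formed over `R ⊗ S`. -/
def translateContract {S : CommAlgCat.{u} k} (h : G.obj S) (l : Module.Dual k S) :
    Module.End k (∀ R : CommAlgCat.{u} k, G.obj R → R) where
  toFun F R g := TensorProduct.rid k R (l.lTensor R
    (F (CommAlgCat.of k (R ⊗[k] S))
      (G.map (CommAlgCat.ofHom Algebra.TensorProduct.includeLeft) g *
        G.map (CommAlgCat.ofHom Algebra.TensorProduct.includeRight) h)))
  map_add' F F' := by
    funext R g
    exact (congrArg _ (map_add (l.lTensor R) _ _)).trans (map_add _ _ _)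
  map_smul' c F := by
    funext R g
    exact (congrArg _ (map_smul (l.lTensor R) _ _)).trans (map_smul _ _ _)

lemma translateContract_characterFunction (χ : characters G) {S : CommAlgCat.{u} k}
    (h : G.obj S) (l : Module.Dual k S) :
    translateContract h l (characterFunction χ) =
      l (characterFunction χ S h) • characterFunction χ := by
  funext R g
  have separates : characterFunction χ (CommAlgCat.of k (R ⊗[k] S))
      (G.map (CommAlgCat.ofHom Algebra.TensorProduct.includeLeft) g *
        G.map (CommAlgCat.ofHom Algebra.TensorProduct.includeRight) h) =
      characterFunction χ R g ⊗ₜ[k] characterFunction χ S h := by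
    rw [characterFunction_mul, characterFunction_map, characterFunction_map]
    exact (Algebra.TensorProduct.tmul_mul_tmul _ _ _ _).trans (by rw [mul_one, one_mul])
  refine (congrArg (fun z => TensorProduct.rid k R (l.lTensor R z)) separates).trans ?_
  rw [LinearMap.lTensor_tmul, TensorProduct.rid_tmul]
  rfl

/-- Characters are joint eigenvectors of the translation operators, and their eigenvalues
determine them because linear forms separate the points of a `k`-algebra. -/
theorem linearIndependent_characterFunction :
    LinearIndependent k (characterFunction (G := G)) := by
  refine linearIndependent_of_joint_eigenvectors
    (κ := Σ S : CommAlgCat.{u} k, G.obj S × Module.Dual k S)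
    (fun j => translateContract j.2.1 j.2.2)
    (fun χ j => translateContract_characterFunction χ j.2.1 j.2.2) (fun χ hχ => ?_) fun χ χ' h => ?_
  · have h := congrFun (congrFun hχ (CommAlgCat.of k k)) 1
    rw [characterFunction_one] at h
    exact one_ne_zero h
  · refine characterFunction_injective (funext fun S => funext fun g => ?_)
    refine sub_eq_zero.1 ((Module.forall_dual_apply_eq_zero_iff k _).1 fun l => ?_)
    rw [map_sub, sub_eq_zero]
    exact congrFun h ⟨S, g, l⟩

/-- The kernel of a character, as a closed subgroup. -/
def characterKer (χ : characters G) : ClosedSubgroup G where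
  carrier R := (χ.1 R).ker
  map_mem f g hg := by
    rw [MonoidHom.mem_ker, χ.2, MonoidHom.mem_ker.1 hg, map_one]
  closed R g := by
    refine ⟨Ideal.span {characterFunction χ R g - 1}, fun S f => ?_⟩
    have h : (∀ a ∈ Ideal.span {characterFunction χ R g - 1}, f.hom a = 0) ↔
        Ideal.span {characterFunction χ R g - 1} ≤ RingHom.ker f.hom := Iff.rfl
    rw [MonoidHom.mem_ker, Units.ext_iff, h, Ideal.span_singleton_le_iff_mem, RingHom.mem_ker,
      map_sub, map_one, sub_eq_zero, ← characterFunction_map]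
    rfl

variable {G' : CommAlgCat.{u} k ⥤ GrpCat.{u + 1}}

/-- Restriction of characters along a homomorphism of group functors. -/
def characterComap (φ : G' ⟶ G) : characters G →* characters G' where
  toFun χ := ⟨fun R => (χ.1 R).comp (φ.app R).hom, fun R S f g => by
    rw [MonoidHom.comp_apply, MonoidHom.comp_apply, ← χ.2]
    exact congrArg (χ.1 S) (ConcreteCategory.congr_hom (φ.naturality f) g)⟩
  map_one' := rfl
  map_mul' _ _ := rfl

lemma finite_ker_characterComap (φ : G' ⟶ G)
    [Module.Finite k (quotientFunctions G (imageSubgroup φ))] :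
    Finite (characterComap φ).ker := by
  let toQuotientFunction (χ : (characterComap φ).ker) :
      quotientFunctions G (imageSubgroup φ) :=
    ⟨characterFunction χ.1, fun _ _ => characterFunction_map χ.1, by
      rintro R g _ ⟨x, rfl⟩
      have trivial_on_image : χ.1.1 R ((φ.app R).hom x) = 1 :=
        DFunLike.congr_fun (congrFun (congrArg Subtype.val χ.2) R) x
      rw [characterFunction_mul]
      exact (congrArg (_ * Units.val ·) trivial_on_image).trans (mul_one _)⟩
  have independent : LinearIndependent k toQuotientFunction :=
    .of_comp (Subalgebra.val _).toLinearMap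
      (linearIndependent_characterFunction.comp _ Subtype.val_injective)
  exact independent.finite_of_isNoetherian

lemma characterComap_eq_one_of_characterKer_eq_imageSubgroup {χ : characters G} {φ : G' ⟶ G}
    (h : (characterKer χ).carrier = imageSubgroup φ) : characterComap φ χ = 1 :=
  Subtype.ext <| funext fun R => MonoidHom.ext fun g => by
    have mem_ker : (φ.app R).hom g ∈ (characterKer χ).carrier R := h ▸ ⟨g, rfl⟩
    exact mem_ker

end Characters

section Points

variable {k K Ω : Type u} [Field k] [Field K] [Field Ω] [Algebra k Ω] [Algebra K Ω]

lemma cancelBaseChange_one_tmul {W T : Type u} [AddCommGroup W] [Module k W] [CommRing T]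
    [Algebra k T] [Algebra Ω T] [IsScalarTower k Ω T] (y : Ω ⊗[k] W) :
    AlgebraTensorModule.cancelBaseChange k Ω T T W (1 ⊗ₜ y) =
      extend W (IsScalarTower.toAlgHom k Ω T) y := by
  induction y with
  | zero => simp
  | add a b ha hb => simp only [TensorProduct.tmul_add, map_add, ha, hb]
  | tmul r w => simp [Algebra.smul_def]

variable [Algebra k K] [IsScalarTower k K Ω] {T : Type u} [CommRing T] [Algebra k T] [Algebra K T]
  [IsScalarTower k K T]

namespace Triple

/-- The isomorphism `T ⊗_K V ≃ T ⊗_k W` obtained from `ψ` by base change along `f : Ω → T`. -/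
def ψAlong (X : Triple k K Ω) (f : Ω →ₐ[K] T) : T ⊗[K] X.V ≃ₗ[T] T ⊗[k] X.W :=
  letI : Algebra Ω T := f.toRingHom.toAlgebra
  haveI : IsScalarTower K Ω T := IsScalarTower.of_algebraMap_eq fun a => (f.commutes a).symm
  haveI : IsScalarTower k Ω T :=
    IsScalarTower.of_algebraMap_eq fun a => ((f.restrictScalars k).commutes a).symm
  (AlgebraTensorModule.cancelBaseChange K Ω T T X.V).symm ≪≫ₗ X.ψ.baseChange Ω T _ _ ≪≫ₗ
    AlgebraTensorModule.cancelBaseChange k Ω T T X.W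

lemma ψAlong_one_tmul (X : Triple k K Ω) (f : Ω →ₐ[K] T) (v : X.V) :
    X.ψAlong f (1 ⊗ₜ v) = extend X.W (f.restrictScalars k) (X.ψ (1 ⊗ₜ v)) := by
  let : Algebra Ω T := f.toRingHom.toAlgebra
  have : IsScalarTower K Ω T := IsScalarTower.of_algebraMap_eq fun a => (f.commutes a).symm
  have : IsScalarTower k Ω T :=
    IsScalarTower.of_algebraMap_eq fun a => ((f.restrictScalars k).commutes a).symm
  have cancel_symm : (AlgebraTensorModule.cancelBaseChange K Ω T T X.V).symm (1 ⊗ₜ v) =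
      1 ⊗ₜ (1 ⊗ₜ v) := AlgebraTensorModule.cancelBaseChange_symm_tmul ..
  refine Eq.trans ?_ (cancelBaseChange_one_tmul (X.ψ (1 ⊗ₜ v)))
  exact congrArg (AlgebraTensorModule.cancelBaseChange k Ω T T X.W)
    ((congrArg _ cancel_symm).trans (LinearMap.baseChange_tmul ..))

lemma hom_ext_along (X : Triple k K Ω) (f : Ω →ₐ[K] T) {M : Type*} [AddCommGroup M] [Module T M]
    {l l' : T ⊗[k] X.W →ₗ[T] M}
    (h : ∀ v, l (extend X.W (f.restrictScalars k) (X.ψ (1 ⊗ₜ v))) =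
      l' (extend X.W (f.restrictScalars k) (X.ψ (1 ⊗ₜ v)))) : l = l' := by
  refine (LinearMap.cancel_right (X.ψAlong f).surjective).1 ?_
  refine (TensorProduct.isBaseChange K X.V T).algHom_ext
    (l ∘ₗ (X.ψAlong f).toLinearMap) (l' ∘ₗ (X.ψAlong f).toLinearMap) fun v => ?_
  change l (X.ψAlong f (1 ⊗ₜ v)) = l' (X.ψAlong f (1 ⊗ₜ v))
  rw [ψAlong_one_tmul, h]

/-- The automorphism of `T ⊗_k W` comparing the base changes of `ψ` along `f₁` and `f₂`. -/
def compare (X : Triple k K Ω) (f₁ f₂ : Ω →ₐ[K] T) :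
    LinearMap.GeneralLinearGroup T (T ⊗[k] X.W) :=
  LinearMap.GeneralLinearGroup.ofLinearEquiv ((X.ψAlong f₁).symm ≪≫ₗ X.ψAlong f₂)

lemma compare_extend_ψ (X : Triple k K Ω) (f₁ f₂ : Ω →ₐ[K] T) (v : X.V) :
    (X.compare f₁ f₂).1 (extend X.W (f₁.restrictScalars k) (X.ψ (1 ⊗ₜ v))) =
      extend X.W (f₂.restrictScalars k) (X.ψ (1 ⊗ₜ v)) := by
  rw [← ψAlong_one_tmul, ← ψAlong_one_tmul]
  exact congrArg (X.ψAlong f₂) ((X.ψAlong f₁).symm_apply_apply _)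

variable (f₁ f₂ : Ω →ₐ[K] T)

lemma compare_naturality {X Y : Triple k K Ω} (φ : X ⟶ Y) :
    (Y.compare f₁ f₂).1 ∘ₗ φ.b.baseChange T = φ.b.baseChange T ∘ₗ (X.compare f₁ f₂).1 := by
  refine X.hom_ext_along f₁ fun v => ?_
  have h := φ.comm (1 ⊗ₜ v)
  rw [LinearMap.baseChange_tmul] at h
  rw [LinearMap.comp_apply, LinearMap.comp_apply, compare_extend_ψ, baseChange_extend,
    baseChange_extend, ← h, compare_extend_ψ]

lemma compare_tensor (X Y : Triple k K Ω) :
    (AlgebraTensorModule.distribBaseChange k T X.W Y.W).toLinearMap ∘ₗ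
        ((X.tensor Y).compare f₁ f₂).1 =
      TensorProduct.map (X.compare f₁ f₂).1 (Y.compare f₁ f₂).1 ∘ₗ
        (AlgebraTensorModule.distribBaseChange k T X.W Y.W).toLinearMap := by
  refine hom_ext_along (M := (T ⊗[k] X.W) ⊗[T] (T ⊗[k] Y.W)) (X.tensor Y) f₁ fun v => ?_
  rw [LinearMap.comp_apply, LinearMap.comp_apply, compare_extend_ψ]
  induction v using TensorProduct.induction_on with
  | zero => simp only [TensorProduct.tmul_zero, map_zero]
  | add a b ha hb => simp only [TensorProduct.tmul_add, map_add, ha, hb]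
  | tmul v w =>
    rw [tensor_ψ, LinearEquiv.coe_coe, distrib_extend_symm, distrib_extend_symm,
      TensorProduct.map_tmul, compare_extend_ψ, compare_extend_ψ]

lemma compare_unit : (unit k K Ω).compare f₁ f₂ = 1 := by
  refine Units.ext ((unit k K Ω).hom_ext_along f₁ fun v => ?_)
  rw [compare_extend_ψ]
  simp [Algebra.smul_def]

end Triple

variable (k) in
/-- The point of the Tannakian group over a `K`-algebra `T` given by two `K`-algebra maps
`f₁, f₂ : Ω → T`; on a triple it is `(f₂^* ψ) ∘ (f₁^* ψ)⁻¹`. -/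
def point (f₁ f₂ : Ω →ₐ[K] T) : (tannakaGroup k K Ω).obj (CommAlgCat.of k T) :=
  ⟨fun X => X.compare f₁ f₂,
    fun _ _ φ => LinearMap.congr_fun (Triple.compare_naturality f₁ f₂ φ),
    fun X Y => LinearMap.congr_fun (Triple.compare_tensor f₁ f₂ X Y),
    Triple.compare_unit f₁ f₂⟩

end Points

section RankOne

section EndScalar

variable {k R : Type u} [Field k] [CommRing R] [Algebra k R]

lemma distribBaseChange_symm_tmul {W W' : Type u} [AddCommGroup W] [Module k W] [AddCommGroup W']
    [Module k W'] (r r' : R) (w : W) (w' : W') :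
    (AlgebraTensorModule.distribBaseChange k R W W').symm ((r ⊗ₜ w) ⊗ₜ (r' ⊗ₜ w')) =
      (r * r') ⊗ₜ (w ⊗ₜ w') := by
  have tmul_eq_smul {V : Type u} [AddCommGroup V] [Module k V] (a : R) (x : V) :
      a ⊗ₜ[k] x = a • (1 ⊗ₜ x) := by rw [TensorProduct.smul_tmul', smul_eq_mul, mul_one]
  rw [LinearEquiv.symm_apply_eq, tmul_eq_smul r, tmul_eq_smul r', tmul_eq_smul (r * r'), map_smul,
    AlgebraTensorModule.distribBaseChange_tmul, TensorProduct.smul_tmul_smul]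

lemma end_apply_tmul_one (e : Module.End R (R ⊗[k] k)) (r : R) :
    e (r ⊗ₜ 1) = (r * AlgebraTensorModule.rid k R R (e (1 ⊗ₜ 1))) ⊗ₜ 1 := by
  apply (AlgebraTensorModule.rid k R R).injective
  rw [← mul_one r, ← smul_eq_mul, ← TensorProduct.smul_tmul', map_smul, map_smul,
    AlgebraTensorModule.rid_tmul, one_smul, smul_eq_mul, smul_eq_mul, mul_one]

variable (R) in
/-- The scalar by which an endomorphism of the free rank one module `R ⊗_k k` acts. -/
def endScalar : Module.End R (R ⊗[k] k) →* R where
  toFun e := AlgebraTensorModule.rid k R R (e (1 ⊗ₜ 1))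
  map_one' := by rw [Module.End.one_apply, AlgebraTensorModule.rid_tmul, one_smul]
  map_mul' e e' := by
    rw [Module.End.mul_apply, end_apply_tmul_one e', end_apply_tmul_one e, one_mul,
      AlgebraTensorModule.rid_tmul, one_smul, AlgebraTensorModule.rid_tmul, one_smul, mul_comm]

lemma endScalar_eq_of_apply {e : Module.End R (R ⊗[k] k)} {r s : R} (h : e (r ⊗ₜ 1) = s ⊗ₜ 1) :
    r * endScalar R e = s := by
  rw [end_apply_tmul_one] at h
  exact (TensorProduct.rid k R).symm.injective h

lemma endScalar_endMap {S : Type u} [CommRing S] [Algebra k S] (f : R →ₐ[k] S)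
    (e : Module.End R (R ⊗[k] k)) : endScalar S (endMap f e) = f (endScalar R e) := by
  refine (one_mul _).symm.trans (endScalar_eq_of_apply ?_)
  rw [endMap_one_tmul, end_apply_tmul_one, extend_tmul, one_mul]
  rfl

end EndScalar

variable {k K Ω : Type u} [Field k] [Field K] [Field Ω] [Algebra k Ω] [Algebra K Ω]

variable (k K) in
/-- The rank one triple `(K, k, u)`. -/
abbrev Triple.line (u : Ωˣ) : Triple k K Ω where
  V := K
  W := k
  ψ := AlgebraTensorModule.rid K Ω Ω ≪≫ₗ LinearEquiv.smulOfUnit u ≪≫ₗ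
    (AlgebraTensorModule.rid k Ω Ω).symm

lemma Triple.line_ψ (u : Ωˣ) (c : K) :
    (Triple.line k K u).ψ ((1 : Ω) ⊗ₜ[K] c) = (u * algebraMap K Ω c) ⊗ₜ[k] (1 : k) := by
  change (AlgebraTensorModule.rid k Ω Ω).symm (u • AlgebraTensorModule.rid K Ω Ω (1 ⊗ₜ c)) = _
  rw [AlgebraTensorModule.rid_tmul, ← Algebra.algebraMap_eq_smul_one]
  rfl

lemma apply_eq_of_hom_id {X : Triple k K Ω} {V : Type u} [AddCommGroup V] [Module K V]
    [Module.Finite K V] {ψ : Ω ⊗[K] V ≃ₗ[Ω] Ω ⊗[k] X.W} (a : X.V →ₗ[K] V)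
    (h : ∀ v, ψ (1 ⊗ₜ a v) = X.ψ (1 ⊗ₜ v)) {R : CommAlgCat.{u} k}
    (g : (tannakaGroup k K Ω).obj R) : g.1 ⟨V, X.W, ψ⟩ = g.1 X := by
  let φ : X ⟶ ⟨V, X.W, ψ⟩ :=
    { a := a
      b := LinearMap.id
      comm := LinearMap.congr_fun ((TensorProduct.isBaseChange K X.V Ω).algHom_ext
        (ψ.toLinearMap ∘ₗ a.baseChange Ω) (LinearMap.id.baseChange Ω ∘ₗ X.ψ.toLinearMap) fun v => by
          simpa using h v) }
  refine Units.ext (LinearMap.ext fun x => ?_)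
  have naturality := g.2.1 _ _ φ x
  simpa [φ] using naturality

/-- Multiplication, as a morphism `(K, k, u) ⊗ (K, k, v) ⟶ (K, k, u v)`. -/
def Triple.lineMul (u v : Ωˣ) :
    (Triple.line k K u).tensor (Triple.line k K v) ⟶ Triple.line k K (u * v) where
  a := LinearMap.mul' K K
  b := LinearMap.mul' k k
  comm := LinearMap.congr_fun <| (TensorProduct.isBaseChange K (K ⊗[K] K) Ω).algHom_ext
    ((Triple.line k K (u * v)).ψ.toLinearMap ∘ₗ (LinearMap.mul' K K).baseChange Ω)
    ((LinearMap.mul' k k).baseChange Ω ∘ₗ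
      ((Triple.line k K u).tensor (Triple.line k K v)).ψ.toLinearMap) fun c => by
    induction c with
    | zero => simp only [map_zero]
    | add a b ha hb => simp only [map_add, ha, hb]
    | tmul c d =>
      change (Triple.line k K (u * v)).ψ (1 ⊗ₜ (c * d)) = (LinearMap.mul' k k).baseChange Ω
        (((Triple.line k K u).tensor (Triple.line k K v)).ψ (1 ⊗ₜ (c ⊗ₜ d)))
      rw [Triple.line_ψ, Triple.tensor_ψ, Triple.line_ψ, Triple.line_ψ,
        distribBaseChange_symm_tmul, LinearMap.baseChange_tmul, LinearMap.mul'_apply, mul_one,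
        map_mul, Units.val_mul, mul_mul_mul_comm]

lemma endScalar_apply_line_mul (u v : Ωˣ) {R : Type u} [CommRing R] [Algebra k R]
    (g : tensorAut k K Ω R) :
    endScalar R (g.1 (Triple.line k K (u * v))).1 =
      endScalar R (g.1 (Triple.line k K u)).1 * endScalar R (g.1 (Triple.line k K v)).1 := by
  have apply_tensor : (g.1 ((Triple.line k K u).tensor (Triple.line k K v))).1
      (1 ⊗ₜ[k] ((1 : k) ⊗ₜ[k] (1 : k))) =
      (endScalar R (g.1 (Triple.line k K u)).1 * endScalar R (g.1 (Triple.line k K v)).1) ⊗ₜ[k]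
        ((1 : k) ⊗ₜ[k] (1 : k)) := by
    rw [← distribBaseChange_symm_tmul, LinearEquiv.eq_symm_apply]
    refine (g.2.2.1 (Triple.line k K u) (Triple.line k K v) _).trans ?_
    rw [AlgebraTensorModule.distribBaseChange_tmul, TensorProduct.map_tmul]
    refine congrArg₂ _ ((end_apply_tmul_one _ _).trans ?_) ((end_apply_tmul_one _ _).trans ?_)
    all_goals rw [one_mul]; rfl
  have naturality := g.2.1 _ _ (Triple.lineMul u v) (1 ⊗ₜ ((1 : k) ⊗ₜ[k] (1 : k)))
  rw [apply_tensor, LinearMap.baseChange_tmul, LinearMap.baseChange_tmul] at naturality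
  refine (one_mul _).symm.trans (endScalar_eq_of_apply ?_)
  simpa [Triple.lineMul] using naturality

variable (k K) in
/-- The character `g ↦ g(K, k, u)` of the Tannakian group defined by a rank one triple. -/
def lineCharacter : Ωˣ →* characters (tannakaGroup k K Ω) :=
  MonoidHom.mk' (fun u =>
    ⟨fun R => (Units.map (endScalar R)).comp
      ((Pi.evalMonoidHom _ (Triple.line k K u)).comp (tensorAut k K Ω R).subtype),
      fun _ _ f _ => Units.ext (endScalar_endMap f.hom _)⟩)
    fun u v => characterFunction_injective <| funext fun _ => funext fun g =>
      endScalar_apply_line_mul u v g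

lemma lineCharacter_eq_one_of_mem_range {u : Ωˣ} (hu : (u : Ω) ∈ Set.range (algebraMap K Ω)) :
    lineCharacter k K u = 1 := by
  obtain ⟨c, hc⟩ := hu
  refine characterFunction_injective (funext fun R => funext fun g => ?_)
  have unit_eq_line : g.1 (Triple.unit k K Ω) = g.1 (Triple.line k K u) :=
    apply_eq_of_hom_id (X := Triple.line k K u) (LinearMap.mulLeft K c) (fun v => by
      rw [Triple.line_ψ, ← hc, ← map_mul, LinearMap.mulLeft_apply]
      simp [Algebra.smul_def]) g
  refine (congrArg (fun e => endScalar R e.1) unit_eq_line.symm).trans ?_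
  rw [g.2.2.2]
  exact map_one _

variable [Algebra k K] [IsScalarTower k K Ω]

lemma mul_characterFunction_lineCharacter_point {T : Type u} [CommRing T] [Algebra k T]
    [Algebra K T] [IsScalarTower k K T] (u : Ωˣ) (f₁ f₂ : Ω →ₐ[K] T) :
    f₁ u * characterFunction (lineCharacter k K u) (CommAlgCat.of k T) (point k f₁ f₂) = f₂ u := by
  refine endScalar_eq_of_apply ?_
  have h := Triple.compare_extend_ψ (Triple.line k K u) f₁ f₂ (1 : K)
  rw [Triple.line_ψ, map_one, mul_one] at h
  exact h

variable (k K Ω) in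
/-- The point of the Tannakian group over `Ω ⊗_K Ω` given by the two inclusions of `Ω`. -/
def universalPoint : (tannakaGroup k K Ω).obj (CommAlgCat.of k (Ω ⊗[K] Ω)) :=
  point k Algebra.TensorProduct.includeLeft Algebra.TensorProduct.includeRight

lemma characterFunction_lineCharacter_universalPoint (u : Ωˣ) :
    characterFunction (lineCharacter k K u) _ (universalPoint k K Ω) = (u : Ω)⁻¹ ⊗ₜ[K] (u : Ω) := by
  have h := mul_characterFunction_lineCharacter_point (k := k) u
    (Algebra.TensorProduct.includeLeft : Ω →ₐ[K] Ω ⊗[K] Ω) Algebra.TensorProduct.includeRight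
  rw [Algebra.TensorProduct.includeLeft_apply, Algebra.TensorProduct.includeRight_apply] at h
  have cancel : (u : Ω)⁻¹ ⊗ₜ[K] (1 : Ω) * (u : Ω) ⊗ₜ[K] (1 : Ω) = 1 := by
    rw [Algebra.TensorProduct.tmul_mul_tmul, inv_mul_cancel₀ u.ne_zero, mul_one,
      Algebra.TensorProduct.one_def]
  calc
    _ = (u : Ω)⁻¹ ⊗ₜ[K] (1 : Ω) * ((u : Ω) ⊗ₜ[K] (1 : Ω) *
        characterFunction (lineCharacter k K u) _ (universalPoint k K Ω)) := by
      rw [← mul_assoc, cancel]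
      exact (one_mul _).symm
    _ = (u : Ω)⁻¹ ⊗ₜ[K] (u : Ω) := by
      refine (congrArg _ h).trans ?_
      rw [Algebra.TensorProduct.tmul_mul_tmul, mul_one, one_mul]

theorem lineCharacter_eq_one_iff {u : Ωˣ} :
    lineCharacter k K u = 1 ↔ (u : Ω) ∈ Set.range (algebraMap K Ω) := by
  refine ⟨fun h => ?_, lineCharacter_eq_one_of_mem_range⟩
  have eq_one := characterFunction_lineCharacter_universalPoint (k := k) (K := K) u
  rw [h] at eq_one
  have tmul_one_eq : (u : Ω) ⊗ₜ[K] (1 : Ω) = (1 : Ω) ⊗ₜ[K] (u : Ω) := by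
    calc
      _ = (u : Ω) ⊗ₜ[K] (1 : Ω) * ((u : Ω)⁻¹ ⊗ₜ[K] (u : Ω)) := by
        rw [← eq_one]
        exact (mul_one _).symm
      _ = (1 : Ω) ⊗ₜ[K] (u : Ω) := by
        rw [Algebra.TensorProduct.tmul_mul_tmul, mul_inv_cancel₀ u.ne_zero, one_mul]
  exact (Algebra.IsEffective.of_faithfullyFlat K Ω (u : Ω)).1 (sub_eq_zero.2 tmul_one_eq)

section Pullback

variable {k K Ω : Type u} [Field k] [Field K] [Field Ω] [Algebra k Ω] [Algebra K Ω]
  (L Ω' : Type u) [Field L] [Field Ω'] [Algebra k Ω'] [Algebra L Ω'] [Algebra K L]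
  [Algebra K Ω'] [IsScalarTower K L Ω'] [Algebra Ω Ω'] [IsScalarTower K Ω Ω']
  [IsScalarTower k Ω Ω']

theorem characterComap_tannakaMap_lineCharacter (u : Ωˣ) :
    characterComap (tannakaMap L Ω') (lineCharacter k K u) =
      lineCharacter k L (Units.map (algebraMap Ω Ω').toMonoidHom u) := by
  refine characterFunction_injective (funext fun R => funext fun g => ?_)
  let line := Triple.line k L (Units.map (algebraMap Ω Ω').toMonoidHom u)
  have ψ_eq (l : L) : ((Triple.line k K u).pullback L Ω').ψ (1 ⊗ₜ (l ⊗ₜ 1)) =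
      line.ψ (1 ⊗ₜ l) := by
    have tmul_eq_smul : (1 : Ω') ⊗ₜ[L] (l ⊗ₜ[K] (1 : K)) =
        algebraMap L Ω' l • (1 ⊗ₜ (1 ⊗ₜ 1)) := by
      rw [algebraMap_smul, ← TensorProduct.tmul_smul, TensorProduct.smul_tmul', smul_eq_mul,
        mul_one]
    rw [tmul_eq_smul, Triple.line_ψ, map_smul]
    refine (congrArg _ ((Triple.line k K u).pullback_ψ L Ω' 1)).trans ?_
    rw [Triple.line_ψ, map_one, mul_one, extend_tmul, TensorProduct.smul_tmul', smul_eq_mul,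
      mul_comm]
    rfl
  have pullback_eq_line : g.1 ((Triple.line k K u).pullback L Ω') = g.1 line :=
    apply_eq_of_hom_id (X := line) (AlgebraTensorModule.rid K L L).symm.toLinearMap ψ_eq g
  exact congrArg (fun e => endScalar R e.1) pullback_eq_line

end Pullback

end RankOne

section RootsOfUnity

open Polynomial

/-- The coordinate ring of the group scheme `μ_n` of `n`-th roots of unity over `k`. -/
abbrev RootsOfUnityRing (k : Type u) [Field k] (n : ℕ) : Type u := AdjoinRoot (X ^ n - 1 : k[X])

namespace RootsOfUnityRing

variable {k : Type u} [Field k] {n : ℕ}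

lemma monic (hn : n ≠ 0) : (X ^ n - 1 : k[X]).Monic := by
  rw [← C_1]
  exact monic_X_pow_sub_C 1 hn

lemma finite (hn : n ≠ 0) : Module.Finite k (RootsOfUnityRing k n) := (monic hn).finite_adjoinRoot

lemma finrank (hn : n ≠ 0) : Module.finrank k (RootsOfUnityRing k n) = n := by
  rw [(AdjoinRoot.powerBasis' (monic hn)).finrank, AdjoinRoot.powerBasis'_dim, ← C_1,
    natDegree_X_pow_sub_C]

variable (k) in
/-- The `R`-valued point of `μ_n` given by an `n`-th root of unity of `R`. -/
def lift {R : Type u} [CommRing R] [Algebra k R] (x : R) (hx : x ^ n = 1) :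
    RootsOfUnityRing k n →ₐ[k] R :=
  AdjoinRoot.liftAlgHom _ (Algebra.ofId k R) x (by simp [hx])

@[simp] lemma lift_root {R : Type u} [CommRing R] [Algebra k R] (x : R) (hx : x ^ n = 1) :
    lift k x hx (AdjoinRoot.root _) = x := AdjoinRoot.liftAlgHom_root ..

lemma algHom_comp_lift {R S : Type u} [CommRing R] [Algebra k R] [CommRing S] [Algebra k S]
    (f : R →ₐ[k] S) (x : R) (hx : x ^ n = 1) :
    f.comp (lift k x hx) = lift k (f x) (by rw [← map_pow, hx, map_one]) :=
  AdjoinRoot.algHom_ext (by simp)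

/-- After base change to `Ω` the map becomes surjective between `Ω`-vector spaces of the same
finite dimension. -/
lemma faithfullyFlat_lift_of_adjoin_eq_top {Ω R : Type u} [Field Ω] [CommRing R] [Algebra k Ω]
    [Algebra Ω R] [Algebra k R] [IsScalarTower k Ω R] (hn : n ≠ 0) {x : R} (hx : x ^ n = 1)
    (adjoin : Algebra.adjoin Ω {x} = ⊤) (rank : Module.finrank Ω R = n) :
    (lift k x hx).toRingHom.FaithfullyFlat := by
  let φ : Ω ⊗[k] RootsOfUnityRing k n →ₐ[Ω] R :=
    Algebra.TensorProduct.lift (Algebra.ofId Ω R) (lift k x hx) fun _ _ => Commute.all ..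
  have surjective : Function.Surjective φ := by
    rw [← AlgHom.range_eq_top, eq_top_iff, ← adjoin]
    exact Algebra.adjoin_singleton_le ⟨1 ⊗ₜ AdjoinRoot.root _, by simp [φ]⟩
  have : Module.Finite k (RootsOfUnityRing k n) := finite hn
  have : Module.Finite Ω R := Module.finite_of_finrank_pos (by omega)
  have injective : Function.Injective φ :=
    (LinearMap.injective_iff_surjective_of_finrank_eq_finrank (f := φ.toLinearMap)
      (by rw [Module.finrank_baseChange, finrank hn, rank])).2 surjective
  have includeRight_flat : (Algebra.TensorProduct.includeRight :
      RootsOfUnityRing k n →ₐ[k] Ω ⊗[k] RootsOfUnityRing k n).toRingHom.FaithfullyFlat :=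
    RingHom.FaithfullyFlat.stableUnderComposition _ _
      (RingHom.faithfullyFlat_algebraMap_iff.2 inferInstance :
        (algebraMap _ (RootsOfUnityRing k n ⊗[k] Ω)).FaithfullyFlat)
      (.of_bijective (Algebra.TensorProduct.comm k (RootsOfUnityRing k n) Ω).bijective)
  have factor : (lift k x hx).toRingHom = φ.toRingHom.comp
      (Algebra.TensorProduct.includeRight :
        RootsOfUnityRing k n →ₐ[k] Ω ⊗[k] RootsOfUnityRing k n).toRingHom :=
    RingHom.ext fun a => by simp [φ]
  rw [factor]
  exact RingHom.FaithfullyFlat.stableUnderComposition _ _ includeRight_flat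
    (.of_bijective ⟨injective, surjective⟩)

end RootsOfUnityRing

attribute [local instance] Algebra.TensorProduct.rightAlgebra in
lemma faithfullyFlat_lTensor (K E A D : Type u) [CommRing K] [CommRing E] [CommRing A]
    [CommRing D] [Algebra K E] [Algebra K A] [Algebra K D] [Algebra E D] [IsScalarTower K E D]
    [Module.FaithfullyFlat E D] :
    (Algebra.TensorProduct.lTensor (S := A) A
      (IsScalarTower.toAlgHom K E D)).toRingHom.FaithfullyFlat := by
  let e := Algebra.IsPushout.cancelBaseChangeAlg K A E (A ⊗[K] E) D
  have factor : (Algebra.TensorProduct.lTensor (S := A) A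
      (IsScalarTower.toAlgHom K E D)).toRingHom =
        e.toRingHom.comp (algebraMap (A ⊗[K] E) ((A ⊗[K] E) ⊗[E] D)) :=
    RingHom.ext fun x => e.symm_apply_eq.1 (DFunLike.congr_fun
      (Algebra.IsPushout.cancelBaseChange_symm_comp_lTensor K E D A) x)
  rw [factor]
  exact RingHom.FaithfullyFlat.stableUnderComposition _ _
    (RingHom.faithfullyFlat_algebraMap_iff.2 inferInstance) (.of_bijective e.bijective)

lemma faithfullyFlat_lift_inv_tmul {k K E Ω : Type u} [Field k] [Field K] [Field E] [Field Ω]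
    [Algebra k Ω] [Algebra K E] [Algebra K Ω] [Algebra E Ω] [IsScalarTower K E Ω]
    (pb : PowerBasis K E) {u : Ωˣ} (hu : algebraMap E Ω pb.gen = u)
    (h : ((u : Ω)⁻¹ ⊗ₜ[K] (u : Ω)) ^ pb.dim = 1) :
    (RootsOfUnityRing.lift k _ h).toRingHom.FaithfullyFlat := by
  let x : Ω ⊗[K] E := (u : Ω)⁻¹ ⊗ₜ pb.gen
  let ι : Ω ⊗[K] E →ₐ[Ω] Ω ⊗[K] Ω :=
    Algebra.TensorProduct.lTensor Ω (IsScalarTower.toAlgHom K E Ω)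
  have ι_flat : ι.toRingHom.FaithfullyFlat := faithfullyFlat_lTensor K E Ω Ω
  have ι_x : ι x = (u : Ω)⁻¹ ⊗ₜ (u : Ω) := congrArg ((u : Ω)⁻¹ ⊗ₜ[K] ·) hu
  have x_pow : x ^ pb.dim = 1 := ι_flat.injective <|
    (map_pow ι x _).trans ((congrArg (· ^ pb.dim) ι_x).trans (h.trans (map_one ι).symm))
  have rank : Module.finrank Ω (Ω ⊗[K] E) = pb.dim := by
    rw [Module.finrank_baseChange, pb.finrank]
  have adjoin : Algebra.adjoin Ω {x} = ⊤ := by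
    rw [eq_top_iff,
      ← Algebra.TensorProduct.adjoin_one_tmul_image_eq_top {pb.gen} pb.adjoin_gen_eq_top,
      Set.image_singleton]
    refine Algebra.adjoin_singleton_le ?_
    have smul_x : (u : Ω) • x = 1 ⊗ₜ pb.gen := by
      rw [TensorProduct.smul_tmul', smul_eq_mul, mul_inv_cancel₀ u.ne_zero]
    rw [← smul_x]
    exact Subalgebra.smul_mem _ (Algebra.self_mem_adjoin_singleton Ω x) _
  have lift_flat : (RootsOfUnityRing.lift k x x_pow).toRingHom.FaithfullyFlat :=
    RootsOfUnityRing.faithfullyFlat_lift_of_adjoin_eq_top pb.dim_pos.ne' x_pow adjoin rank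
  have factor : (RootsOfUnityRing.lift k _ h).toRingHom =
      ι.toRingHom.comp (RootsOfUnityRing.lift k x x_pow).toRingHom := by
    have comp_lift := RootsOfUnityRing.algHom_comp_lift (ι.restrictScalars k) x x_pow
    simp only [AlgHom.restrictScalars_apply, ι_x] at comp_lift
    exact congrArg AlgHom.toRingHom comp_lift.symm
  rw [factor]
  exact RingHom.FaithfullyFlat.stableUnderComposition _ _ lift_flat ι_flat

section CharacterKer

variable {k : Type u} [Field k] {G : CommAlgCat.{u} k ⥤ GrpCat.{u + 1}}

lemma characterFunction_pow_eq_one {χ : characters G} {n : ℕ} (hχ : χ ^ n = 1)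
    (R : CommAlgCat.{u} k) (g : G.obj R) : characterFunction χ R g ^ n = 1 :=
  congrArg Units.val (DFunLike.congr_fun (congrFun (congrArg Subtype.val hχ) R) g)

lemma characterFunction_eq_iff {χ : characters G} {R : CommAlgCat.{u} k} {g g' : G.obj R} :
    characterFunction χ R g = characterFunction χ R g' ↔
      g⁻¹ * g' ∈ (characterKer χ).carrier R := by
  refine Units.ext_iff.symm.trans ?_
  change _ ↔ χ.1 R (g⁻¹ * g') = 1
  rw [map_mul, map_inv, inv_mul_eq_one]

theorem finite_quotientFunctions_characterKer {χ : characters G} {n : ℕ} (hn : n ≠ 0)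
    (hχ : χ ^ n = 1) {S : CommAlgCat.{u} k} (g : G.obj S)
    (flat : (RootsOfUnityRing.lift k (characterFunction χ S g)
      (characterFunction_pow_eq_one hχ S g)).toRingHom.FaithfullyFlat) :
    Module.Finite k (quotientFunctions G (characterKer χ).carrier) := by
  let q (R : CommAlgCat.{u} k) (g : G.obj R) : CommAlgCat.of k (RootsOfUnityRing k n) ⟶ R :=
    CommAlgCat.ofHom (RootsOfUnityRing.lift k _ (characterFunction_pow_eq_one hχ R g))
  have q_root (R : CommAlgCat.{u} k) (g : G.obj R) :
      (q R g).hom (AdjoinRoot.root _) = characterFunction χ R g :=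
    RootsOfUnityRing.lift_root _ (characterFunction_pow_eq_one hχ R g)
  have : Module.Finite k (CommAlgCat.of k (RootsOfUnityRing k n)) := RootsOfUnityRing.finite hn
  refine finite_quotientFunctions_of_generic_lift (q := q) (fun R S f g => ?_)
    (fun R g g' h => ?_) g flat
  · refine CommAlgCat.hom_ext (AdjoinRoot.algHom_ext ?_)
    exact (q_root S _).trans ((characterFunction_map χ f g).trans
      (congrArg f.hom (q_root R g).symm))
  · rw [← characterFunction_eq_iff, ← q_root, ← q_root, h]

theorem finite_quotientFunctions_characterKer_lineCharacter {K E Ω : Type u} [Field K] [Field E]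
    [Field Ω] [Algebra k K] [Algebra k Ω] [Algebra K E] [Algebra K Ω] [Algebra E Ω]
    [IsScalarTower k K Ω] [IsScalarTower K E Ω] (pb : PowerBasis K E) {u : Ωˣ}
    (gen_eq : algebraMap E Ω pb.gen = u)
    (pow_mem : (u : Ω) ^ pb.dim ∈ Set.range (algebraMap K Ω)) :
    Module.Finite k (quotientFunctions (tannakaGroup k K Ω)
      (characterKer (lineCharacter k K u)).carrier) := by
  have lineCharacter_pow : lineCharacter k K u ^ pb.dim = 1 := by
    rw [← map_pow, lineCharacter_eq_one_iff, Units.val_pow_eq_pow_val]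
    exact pow_mem
  refine finite_quotientFunctions_characterKer pb.dim_pos.ne' lineCharacter_pow
    (universalPoint k K Ω) ?_
  have flat {y : Ω ⊗[K] Ω} (hy : y = (u : Ω)⁻¹ ⊗ₜ (u : Ω)) (y_pow : y ^ pb.dim = 1) :
      (RootsOfUnityRing.lift k y y_pow).toRingHom.FaithfullyFlat := by
    subst hy
    exact faithfullyFlat_lift_inv_tmul pb gen_eq y_pow
  exact flat (characterFunction_lineCharacter_universalPoint u)
    (characterFunction_pow_eq_one lineCharacter_pow _ (universalPoint k K Ω))

end CharacterKer

end RootsOfUnity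

section UnitsQuotient

variable {K L : Type u} [Field K] [Field L] [Algebra K L]

lemma mem_range_unitsMap_algebraMap_iff {u : Lˣ} :
    u ∈ (Units.map (algebraMap K L).toMonoidHom).range ↔ (u : L) ∈ Set.range (algebraMap K L) := by
  refine ⟨fun ⟨c, hc⟩ => ⟨c, congrArg Units.val hc⟩, fun ⟨c, hc⟩ => ?_⟩
  have c_ne_zero : c ≠ 0 := by
    rintro rfl
    exact u.ne_zero (hc.symm.trans (map_zero _))
  exact ⟨Units.mk0 c c_ne_zero, Units.ext hc⟩

lemma eq_of_one_add_mul_eq_mul {α : L} (hα : α ∉ Set.range (algebraMap K L)) {a b c : K}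
    (h : 1 + algebraMap K L a * α = algebraMap K L c * (1 + algebraMap K L b * α)) : a = b := by
  have linear : algebraMap K L (a - c * b) * α = algebraMap K L (c - 1) := by
    simp only [map_sub, map_mul, map_one]
    linear_combination h
  have slope : a - c * b = 0 := by
    by_contra hne
    refine hα ⟨(c - 1) / (a - c * b), ?_⟩
    rw [map_div₀, ← linear, mul_div_cancel_left₀]
    exact (map_ne_zero _).2 hne
  have constant : c = 1 := by
    rw [slope, map_zero, zero_mul, eq_comm, map_eq_zero, sub_eq_zero] at linear
    exact linear
  rwa [constant, one_mul, sub_eq_zero] at slope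

lemma infinite_unitsQuotient [Infinite K] (hL : ¬ Function.Surjective (algebraMap K L)) :
    Infinite (unitsQuotient K L) := by
  obtain ⟨α, hα⟩ : ∃ α, α ∉ Set.range (algebraMap K L) := not_forall.1 hL
  have ne_zero (a : K) : 1 + algebraMap K L a * α ≠ 0 := fun h => by
    have := eq_of_one_add_mul_eq_mul hα (a := a) (b := a + 1) (c := 0) (by rw [h]; simp)
    simp at this
  refine Infinite.of_injective (fun a : K =>
    (QuotientGroup.mk (Units.mk0 _ (ne_zero a)) : unitsQuotient K L)) fun a b hab => ?_
  obtain ⟨c, hc⟩ := mem_range_unitsMap_algebraMap_iff.1 (QuotientGroup.eq.1 hab.symm)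
  refine eq_of_one_add_mul_eq_mul hα (c := c) ?_
  rw [hc, Units.val_mul, Units.val_inv_eq_inv_val, Units.val_mk0, Units.val_mk0, mul_right_comm,
    inv_mul_cancel₀ (ne_zero b), one_mul]

section PurelyInseparable

variable [IsPurelyInseparable K L]

lemma infinite_of_isPurelyInseparable (hL : ¬ Function.Surjective (algebraMap K L)) :
    Infinite K :=
  not_finite_iff_infinite.1 fun _ => hL <|
    IsPurelyInseparable.surjective_algebraMap_of_isSeparable K L

lemma isMulTorsion_unitsQuotient : IsMulTorsion (unitsQuotient K L) := by
  intro x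
  obtain ⟨u, rfl⟩ := QuotientGroup.mk_surjective x
  obtain ⟨n, hn⟩ := IsPurelyInseparable.pow_mem K (ringExpChar K) (u : L)
  refine isOfFinOrder_iff_pow_eq_one.2 ⟨_, pow_pos (expChar_pos K (ringExpChar K)) n, ?_⟩
  rw [← QuotientGroup.mk_pow, QuotientGroup.eq_one_iff, mem_range_unitsMap_algebraMap_iff]
  exact hn

theorem infinite_and_not_fg_unitsQuotient (hL : ¬ Function.Surjective (algebraMap K L)) :
    Infinite (unitsQuotient K L) ∧ ¬ Group.FG (unitsQuotient K L) := by
  have := infinite_of_isPurelyInseparable hL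
  have infinite := infinite_unitsQuotient hL
  exact ⟨infinite, fun _ => not_finite_iff_infinite.2 infinite
    (CommGroup.finite_of_fg_isMulTorsion _ isMulTorsion_unitsQuotient)⟩

end PurelyInseparable

open Polynomial

variable {n : ℕ} {c : K} [Fact (Irreducible (X ^ n - C c))]

lemma isPurelyInseparable_adjoinRoot_X_pow_sub_C [ExpChar K n] :
    IsPurelyInseparable K (AdjoinRoot (X ^ n - C c)) := by
  rw [isPurelyInseparable_iff_perfectClosure_eq_top, eq_top_iff,
    ← IntermediateField.adjoin_root_eq_top, IntermediateField.adjoin_simple_le_iff,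
    mem_perfectClosure_iff_pow_mem n]
  exact ⟨1, c, by rw [pow_one]; exact (root_X_pow_sub_C_pow n c).symm⟩

lemma not_surjective_algebraMap_adjoinRoot_X_pow_sub_C (hc : ∀ d : K, d ^ n ≠ c) :
    ¬ Function.Surjective (algebraMap K (AdjoinRoot (X ^ n - C c))) := fun surjective => by
  obtain ⟨d, hd⟩ := surjective (AdjoinRoot.root _)
  have root_pow := root_X_pow_sub_C_pow n c
  rw [← hd, ← map_pow] at root_pow
  exact hc d ((algebraMap K (AdjoinRoot (X ^ n - C c))).injective root_pow)

end UnitsQuotient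

section TannakaMap

variable {k K Ω : Type u} [Field k] [Field K] [Field Ω] [Algebra k K] [Algebra k Ω] [Algebra K Ω]
  [IsScalarTower k K Ω] (L Ω' : Type u) [Field L] [Field Ω'] [Algebra k Ω'] [Algebra L Ω']
  [Algebra K L] [Algebra K Ω'] [IsScalarTower K L Ω'] [Algebra Ω Ω'] [IsScalarTower K Ω Ω']
  [IsScalarTower k Ω Ω']

lemma infinite_ker_characterComap_tannakaMap {M : IntermediateField K Ω}
    (hM : ∀ x ∈ M, algebraMap Ω Ω' x ∈ Set.range (algebraMap L Ω')) [Infinite (unitsQuotient K M)] :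
    Infinite (characterComap (tannakaMap L Ω' : tannakaGroup k L Ω' ⟶ tannakaGroup k K Ω)).ker := by
  let χ : Mˣ →* (characterComap (tannakaMap L Ω' :
      tannakaGroup k L Ω' ⟶ tannakaGroup k K Ω)).ker :=
    ((lineCharacter k K).comp (Units.map (algebraMap M Ω).toMonoidHom)).codRestrict _ fun u => by
      rw [MonoidHom.mem_ker, MonoidHom.comp_apply, characterComap_tannakaMap_lineCharacter]
      exact lineCharacter_eq_one_of_mem_range (hM u.1 u.1.2)
  have ker_eq : χ.ker = (Units.map (algebraMap K M).toMonoidHom).range := by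
    ext u
    rw [MonoidHom.mem_ker, Subtype.ext_iff, mem_range_unitsMap_algebraMap_iff]
    exact lineCharacter_eq_one_iff.trans (exists_congr fun a =>
      (Subtype.ext_iff (a1 := algebraMap K M a) (a2 := u)).symm)
  exact Infinite.of_injective _ ((QuotientGroup.kerLift_injective χ).comp
    (QuotientGroup.quotientMulEquivOfEq ker_eq).symm.injective)

variable [IsPurelyInseparable K Ω]

variable (K) in
lemma pow_natDegree_minpoly_mem_range (x : Ω) :
    x ^ (minpoly K x).natDegree ∈ Set.range (algebraMap K Ω) := by
  obtain ⟨n, c, hc⟩ := IsPurelyInseparable.minpoly_eq_X_pow_sub_C K (ringExpChar K) x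
  have root := minpoly.aeval K x
  rw [hc, map_sub, map_pow, Polynomial.aeval_X, Polynomial.aeval_C, sub_eq_zero] at root
  exact ⟨c, by rw [hc, Polynomial.natDegree_X_pow_sub_C, root]⟩

theorem not_finite_quotientFunctions_tannakaMap {u : Ω} (hu : u ∉ Set.range (algebraMap K Ω))
    (hu' : algebraMap Ω Ω' u ∈ Set.range (algebraMap L Ω')) :
    ¬ Module.Finite k (quotientFunctions (tannakaGroup k K Ω)
      (imageSubgroup (tannakaMap L Ω'))) := by
  intro finite
  let M : IntermediateField K Ω :=
    (IsScalarTower.toAlgHom K L Ω').fieldRange.comap (IsScalarTower.toAlgHom K Ω Ω')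
  have not_surjective : ¬ Function.Surjective (algebraMap K M) := fun surjective =>
    hu ((surjective ⟨u, hu'⟩).imp fun _ => congrArg Subtype.val)
  have := infinite_of_isPurelyInseparable not_surjective
  have := infinite_unitsQuotient not_surjective
  have infinite := infinite_ker_characterComap_tannakaMap (k := k) L Ω' (M := M) fun _ hx => hx
  exact infinite.not_finite (finite_ker_characterComap _)

theorem characterKer_lineCharacter_ne_imageSubgroup [Algebra k L] [IsScalarTower k L Ω'] {u : Ωˣ}
    (hu : (u : Ω) ∉ Set.range (algebraMap K Ω)) :
    (characterKer (lineCharacter k K u)).carrier ≠ imageSubgroup (tannakaMap L Ω') := by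
  intro h
  have comap_eq_one := characterComap_eq_one_of_characterKer_eq_imageSubgroup h
  rw [characterComap_tannakaMap_lineCharacter, lineCharacter_eq_one_iff] at comap_eq_one
  refine not_finite_quotientFunctions_tannakaMap (k := k) L Ω' hu comap_eq_one ?_
  rw [← h]
  have integral : IsIntegral K (u : Ω) := Algebra.IsIntegral.isIntegral _
  exact finite_quotientFunctions_characterKer_lineCharacter
    (IntermediateField.adjoin.powerBasis integral) (by simp) <| by
      rw [IntermediateField.adjoin.powerBasis_dim]
      exact pow_natDegree_minpoly_mem_range K _

end TannakaMap

section PerfectClosure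

variable {p : ℕ} [Fact p.Prime] {k K L : Type u} [Field k] [Field K] [CharP K p] [Field L]
  [CharP L p] [Algebra k K] [Algebra k L] [Algebra K L] [IsScalarTower k K L]

instance isScalarTower_perfectClosure : IsScalarTower k K (PerfectClosure K p) :=
  IsScalarTower.of_algebraMap_eq fun _ => rfl

instance isPurelyInseparable_perfectClosure : IsPurelyInseparable K (PerfectClosure K p) :=
  have : IsPRadical (algebraMap K (PerfectClosure K p)) p := PerfectClosure.isPRadical K p
  IsPRadical.isPurelyInseparable K _ p

variable (p K) in
lemma exists_notMem_range_algebraMap_perfectClosure (hK : ¬ PerfectField K) :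
    ∃ x : PerfectClosure K p, x ∉ Set.range (algebraMap K (PerfectClosure K p)) := by
  by_contra! surjective
  exact hK (PerfectField.of_ringEquiv (RingEquiv.ofBijective (algebraMap K (PerfectClosure K p))
    ⟨(algebraMap K (PerfectClosure K p)).injective, surjective⟩).symm)

lemma exists_perfectClosureMap_eq [IsPurelyInseparable K L] (y : L) :
    ∃ x : PerfectClosure K p, perfectClosureMap p K L x = PerfectClosure.of L p y := by
  obtain ⟨n, c, hc⟩ := IsPurelyInseparable.pow_mem K p y
  obtain ⟨x, hx⟩ :=
    (bijective_iterateFrobenius (PerfectClosure K p) p n).surjective (PerfectClosure.of K p c)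
  refine ⟨x, iterateFrobenius_inj (PerfectClosure L p) p n ?_⟩
  rw [← RingHom.map_iterateFrobenius, hx, perfectClosureMap_of, hc, iterateFrobenius_def, map_pow]

variable (p K L) in
/-- The algebra structure on `L^perf` over `K^perf` given by the functoriality of the perfect
closure. It is only used locally, as it is not definitionally the identity when `L = K`. -/
abbrev perfectClosureMapAlgebra : Algebra (PerfectClosure K p) (PerfectClosure L p) :=
  (perfectClosureMap p K L).toAlgebra

attribute [local instance] perfectClosureMapAlgebra

lemma isScalarTower_perfectClosure_bot :
    IsScalarTower K (PerfectClosure K p) (PerfectClosure L p) :=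
  IsScalarTower.of_algebraMap_eq fun x => (perfectClosureMap_of p K L x).symm

lemma isScalarTower_perfectClosure_top :
    IsScalarTower k (PerfectClosure K p) (PerfectClosure L p) :=
  IsScalarTower.of_algebraMap_eq fun x => by
    rw [perfectClosure_algebraMap, IsScalarTower.algebraMap_apply k K L]
    exact (perfectClosureMap_of p K L _).symm

attribute [local instance] isScalarTower_perfectClosure_bot isScalarTower_perfectClosure_top

variable (k) in
theorem exists_closedSubgroup_ne_imageSubgroup (hK : ¬ PerfectField K) :
    ∃ H : ClosedSubgroup (localNoriGroup p k K),
      ∀ (L : Type u) [Field L] [CharP L p] [Algebra k L] [Algebra K L] [IsScalarTower k K L],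
        H.carrier ≠ imageSubgroup (localNoriGroupMap p k K L) := by
  obtain ⟨x, hx⟩ := exists_notMem_range_algebraMap_perfectClosure p K hK
  have x_ne_zero : x ≠ 0 := fun h => hx ⟨0, by rw [h, map_zero]⟩
  exact ⟨characterKer (lineCharacter k K (Units.mk0 x x_ne_zero)), fun L _ _ _ _ _ =>
    characterKer_lineCharacter_ne_imageSubgroup L (PerfectClosure L p) hx⟩

theorem not_finite_quotientFunctions_localNoriGroupMap [IsPurelyInseparable K L]
    (hL : ¬ Function.Surjective (algebraMap K L)) :
    ¬ Module.Finite k (quotientFunctions (localNoriGroup p k K)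
      (imageSubgroup (localNoriGroupMap p k K L))) := by
  obtain ⟨y, hy⟩ := not_forall.1 hL
  obtain ⟨x, hx⟩ := exists_perfectClosureMap_eq (p := p) (K := K) y
  refine not_finite_quotientFunctions_tannakaMap L (PerfectClosure L p) (u := x) ?_ ⟨y, hx.symm⟩
  rintro ⟨c, rfl⟩
  exact hy ⟨c, (PerfectClosure.of L p).injective ((perfectClosureMap_of p K L c).symm.trans hx)⟩

end PerfectClosure

end LocalNori

end

open LocalNori in
theorem mainTheorem3_general (p : ℕ) [Fact p.Prime] (k K : Type u) [Field k] [Field K]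
    [CharP K p] [Algebra k K] :
    (¬ PerfectField K → ∃ H : ClosedSubgroup (localNoriGroup p k K),
      ∀ (L : Type u) [Field L] [CharP L p] [Algebra k L] [Algebra K L] [IsScalarTower k K L],
        H.carrier ≠ imageSubgroup (localNoriGroupMap p k K L)) ∧
    (∀ (L : Type u) [Field L] [CharP L p] [Algebra k L] [Algebra K L] [IsScalarTower k K L]
      [IsPurelyInseparable K L], ¬ Function.Surjective (algebraMap K L) →
        ¬ QuotientIsFinite (localNoriGroup p k K) (imageSubgroup (localNoriGroupMap p k K L)) ∧
        ¬ Module.Finite k (quotientFunctions (localNoriGroup p k K)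
          (imageSubgroup (localNoriGroupMap p k K L)))) ∧
    (∀ (L : Type u) [Field L] [Algebra K L] [IsPurelyInseparable K L],
      ¬ Function.Surjective (algebraMap K L) →
        Infinite (unitsQuotient K L) ∧ ¬ Group.FG (unitsQuotient K L)) :=
  ⟨exists_closedSubgroup_ne_imageSubgroup k,
    fun _ _ _ _ _ _ _ hL =>
      have not_finite := not_finite_quotientFunctions_localNoriGroupMap hL
      ⟨fun h => not_finite h.finite_quotientFunctions, not_finite⟩,
    fun _ _ _ _ => infinite_and_not_fg_unitsQuotient⟩

open LocalNori Polynomial in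
theorem mainTheorem3 (p : ℕ) [Fact p.Prime] (k K : Type u) [Field k] [CharP k p] [PerfectField k]
    [Field K] [CharP K p] [Algebra k K] (hK : ¬ PerfectField K) :
    (∃ H : ClosedSubgroup (localNoriGroup p k K),
      ∀ (L : Type u) [Field L] [CharP L p] [Algebra k L] [Algebra K L] [IsScalarTower k K L]
        [IsPurelyInseparable K L],
        H.carrier ≠ imageSubgroup (localNoriGroupMap p k K L)) ∧
    (∀ (L : Type u) [Field L] [CharP L p] [Algebra k L] [Algebra K L] [IsScalarTower k K L]
      [IsPurelyInseparable K L], ¬ Function.Surjective (algebraMap K L) →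
        ¬ QuotientIsFinite (localNoriGroup p k K) (imageSubgroup (localNoriGroupMap p k K L)) ∧
        ¬ Module.Finite k (quotientFunctions (localNoriGroup p k K)
          (imageSubgroup (localNoriGroupMap p k K L)))) ∧
    (∀ c : K, (∀ d : K, d ^ p ≠ c) →
      Infinite (unitsQuotient K (AdjoinRoot (X ^ p - C c))) ∧
      ¬ Group.FG (unitsQuotient K (AdjoinRoot (X ^ p - C c)))) := by
  obtain ⟨exists_subgroup, not_finite, units⟩ := mainTheorem3_general p k K
  obtain ⟨H, hH⟩ := exists_subgroup hK
  refine ⟨⟨H, fun L _ _ _ _ _ _ => hH L⟩, not_finite, fun c hc => ?_⟩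
  have : Fact (Irreducible (X ^ p - C c)) := ⟨X_pow_sub_C_irreducible_of_prime Fact.out hc⟩
  have : IsPurelyInseparable K (AdjoinRoot (X ^ p - C c)) :=
    isPurelyInseparable_adjoinRoot_X_pow_sub_C
  exact units _ (not_surjective_algebraMap_adjoinRoot_X_pow_sub_C hc)
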